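/- Let $K$ be a number field with algebraic closure $\overline{K}$, let $X$ be a projective variety over $K$ (an integral scheme, projective over $K$), let $f_1,\dots,f_k : X\to X$ be morphisms over $K$, and let $L\in \operatorname{Pic}(X)\otimes_{\mathbb{Z}}\mathbb{R}$ be an $\mathbb{R}$-line bundle such that $\sum_{i=1}^k f_i^*L = d\,L$ in $\operatorname{Pic}(X)\otimes_{\mathbb{Z}}\mathbb{R}$ for some real number $d>k$. Let $\widehat h_{L,\mathcal F}: X(\overline{K})\to\mathbb{R}$ be the canonical height function associated with $L$ and $\mathcal F=\{f_1,\dots,f_k\}$, i.e. the function such that (i) $\widehat h_{L,\mathcal F}=h_L+O(1)$, where $h_L$ is a Weil height corresponding to $L$, and (ii) $\sum_{i=1}^k \widehat h_{L,\mathcal F}(f_i(x)) = d\,\widehat h_{L,\mathcal F}(x)$ for all $x\in X(\overline K)$. For $x\in X(\overline K)$ let $$C(x)=\{f_{i_1}\circ\cdots\circ f_{i_l}(x) \mid l\ge 0,\ 1\le i_1,\dots,i_l\le k\}$$ be its forward orbit. Assume that $L$ is ample, i.e. $L=\sum_j r_jL_j$ in $\operatorname{Pic}(X)\otimes_{\mathbb{Z}}\mathbb{R}$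 for a finite non-empty family of real numbers $r_j>0$ and ample line bundles $L_j$ on $X$. Then: 1. $\widehat h_{L,\mathcal F}(x)\ge 0$ for all $x\in X(\overline K)$. 2. For every $x\in X(\overline K)$, $\widehat h_{L,\mathcal F}(x)=0$ if and only if $C(x)$ is finite. -/

import Mathlib

open AlgebraicGeometry CategoryTheory TensorProduct

universe u

noncomputable section

namespace CanonicalHeight

/-! ### Line bundles and the Picard group of a scheme -/

/-- Restriction of invertible functions to a smaller open set. -/
def resUnit {X : Scheme.{u}} {U V : X.Opens} (h : V ≤ U) : Γ(X, U)ˣ →* Γ(X, V)ˣ :=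
  Units.map (X.presheaf.map (homOfLE h).op).hom.toMonoidHom

/-- Pullback of invertible functions along a morphism. -/
def pullUnit {X Y : Scheme.{u}} (f : Y ⟶ X) (U : X.Opens) (V : Y.Opens) (h : V ≤ f ⁻¹ᵁ U) :
    Γ(X, U)ˣ →* Γ(Y, V)ˣ :=
  Units.map (f.appLE U V h).hom.toMonoidHom

theorem resUnit_resUnit {X : Scheme.{u}} {U V W : X.Opens} (h : V ≤ U) (h' : W ≤ V)
    (a : Γ(X, U)ˣ) : resUnit h' (resUnit h a) = resUnit (h'.trans h) a := by
  ext
  simp only [resUnit, Units.coe_map, RingHom.toMonoidHom_eq_coe, MonoidHom.coe_coe]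
  rw [← CommRingCat.comp_apply, ← Functor.map_comp]
  rfl

theorem resUnit_pullUnit {X Y : Scheme.{u}} (f : Y ⟶ X) {U : X.Opens} {V W : Y.Opens}
    (h : V ≤ f ⁻¹ᵁ U) (h' : W ≤ V) (a : Γ(X, U)ˣ) :
    resUnit h' (pullUnit f U V h a) = pullUnit f U W (h'.trans h) a := by
  ext
  simp only [resUnit, pullUnit, Units.coe_map, RingHom.toMonoidHom_eq_coe, MonoidHom.coe_coe]
  rw [← CommRingCat.comp_apply, Scheme.Hom.appLE_map]

theorem pullUnit_resUnit {X Y : Scheme.{u}} (f : Y ⟶ X) {U U' : X.Opens} {V : Y.Opens}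
    (hU : U' ≤ U) (h : V ≤ f ⁻¹ᵁ U') (a : Γ(X, U)ˣ) :
    pullUnit f U' V h (resUnit hU a) =
      pullUnit f U V (h.trans (f.preimage_mono hU)) a := by
  ext
  simp only [resUnit, pullUnit, Units.coe_map, RingHom.toMonoidHom_eq_coe, MonoidHom.coe_coe]
  rw [← CommRingCat.comp_apply, Scheme.Hom.map_appLE]

theorem le_preimage_inf {X Y : Scheme.{u}} (f : Y ⟶ X) {U V : X.Opens} {W : Y.Opens}
    (hU : W ≤ f ⁻¹ᵁ U) (hV : W ≤ f ⁻¹ᵁ V) : W ≤ f ⁻¹ᵁ (U ⊓ V) :=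
  le_inf hU hV

/-- A line bundle on `X`, given by local trivialisations and transition functions: an open
neighbourhood `chart x` of every point `x`, over which the bundle is trivialised, and invertible
functions `trans x y` on the overlaps satisfying the cocycle condition. A section of the bundle is
a family of functions `s x` on `chart x` with `s x = trans x y * s y` on overlaps. -/
structure LineBundle (X : Scheme.{u}) where
  /-- the trivialising open neighbourhood of a point -/
  chart : X → X.Opens
  mem_chart : ∀ x, x ∈ chart x
  /-- the transition functions -/
  trans : ∀ x y, Γ(X, chart x ⊓ chart y)ˣ
  cocycle : ∀ (x y z : X) (W : X.Opens) (hx : W ≤ chart x) (hy : W ≤ chart y) (hz : W ≤ chart z),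
    resUnit (le_inf hx hy) (trans x y) * resUnit (le_inf hy hz) (trans y z) =
      resUnit (le_inf hx hz) (trans x z)

namespace LineBundle

variable {X Y : Scheme.{u}}

/-- The transition function from `y` to `x`, restricted to a smaller open set. -/
def transOn (L : LineBundle X) (x y : X) (W : X.Opens) (hx : W ≤ L.chart x) (hy : W ≤ L.chart y) :
    Γ(X, W)ˣ :=
  resUnit (le_inf hx hy) (L.trans x y)

theorem resUnit_transOn (L : LineBundle X) (x y : X) {V W : X.Opens} (hx : V ≤ L.chart x)
    (hy : V ≤ L.chart y) (h : W ≤ V) :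
    resUnit h (L.transOn x y V hx hy) = L.transOn x y W (h.trans hx) (h.trans hy) :=
  resUnit_resUnit _ _ _

theorem transOn_mul (L : LineBundle X) (x y z : X) (W : X.Opens) (hx : W ≤ L.chart x)
    (hy : W ≤ L.chart y) (hz : W ≤ L.chart z) :
    L.transOn x y W hx hy * L.transOn y z W hy hz = L.transOn x z W hx hz :=
  L.cocycle x y z W hx hy hz

/-- Two line bundles are isomorphic if, on neighbourhoods `V x` contained in the charts of both,
there are invertible functions `h x` that carry the transition functions of the first to those of
the second. -/
def Iso (L M : LineBundle X) : Prop :=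
  ∃ (V : X → X.Opens) (hL : ∀ x, V x ≤ L.chart x) (hM : ∀ x, V x ≤ M.chart x)
    (h : ∀ x, Γ(X, V x)ˣ), (∀ x, x ∈ V x) ∧
    ∀ (x y : X) (W : X.Opens) (hx : W ≤ V x) (hy : W ≤ V y),
      resUnit hx (h x) * L.transOn x y W (hx.trans (hL x)) (hy.trans (hL y)) =
        M.transOn x y W (hx.trans (hM x)) (hy.trans (hM y)) * resUnit hy (h y)

theorem Iso.refl (L : LineBundle X) : L.Iso L :=
  ⟨L.chart, fun _ => le_rfl, fun _ => le_rfl, fun _ => 1, L.mem_chart, fun x y W hx hy => by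
    rw [map_one, map_one, one_mul, mul_one]⟩

theorem Iso.symm {L M : LineBundle X} : L.Iso M → M.Iso L := by
  rintro ⟨V, hL, hM, h, hV, H⟩
  refine ⟨V, hM, hL, fun x => (h x)⁻¹, hV, fun x y W hx hy => ?_⟩
  rw [map_inv, map_inv, inv_mul_eq_iff_eq_mul, ← mul_assoc, H x y W hx hy, mul_inv_cancel_right]

theorem Iso.trans {L M N : LineBundle X} : L.Iso M → M.Iso N → L.Iso N := by
  rintro ⟨V, hL, hM, h, hV, H⟩ ⟨V', hM', hN', h', hV', H'⟩
  refine ⟨fun x => V x ⊓ V' x, fun x => inf_le_left.trans (hL x),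
    fun x => inf_le_right.trans (hN' x),
    fun x => resUnit inf_le_right (h' x) * resUnit inf_le_left (h x),
    fun x => ⟨hV x, hV' x⟩, fun x y W hx hy => ?_⟩
  have e := H x y W (hx.trans inf_le_left) (hy.trans inf_le_left)
  have e' := H' x y W (hx.trans inf_le_right) (hy.trans inf_le_right)
  rw [map_mul, map_mul, resUnit_resUnit, resUnit_resUnit, resUnit_resUnit, resUnit_resUnit,
    mul_assoc, e, ← mul_assoc, e', mul_assoc]

instance setoid (X : Scheme.{u}) : Setoid (LineBundle X) where
  r := Iso
  iseqv := ⟨Iso.refl, Iso.symm, Iso.trans⟩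

/-- The trivial line bundle. -/
def trivial (X : Scheme.{u}) : LineBundle X where
  chart _ := ⊤
  mem_chart _ := _root_.trivial
  trans _ _ := 1
  cocycle x y z W hx hy hz := by simp only [map_one, mul_one]

/-- The tensor product of two line bundles. -/
def tensor (L M : LineBundle X) : LineBundle X where
  chart x := L.chart x ⊓ M.chart x
  mem_chart x := ⟨L.mem_chart x, M.mem_chart x⟩
  trans x y :=
    L.transOn x y _ (inf_le_left.trans inf_le_left) (inf_le_right.trans inf_le_left) *
      M.transOn x y _ (inf_le_left.trans inf_le_right) (inf_le_right.trans inf_le_right)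
  cocycle x y z W hx hy hz := by
    rw [map_mul, map_mul, map_mul, resUnit_transOn, resUnit_transOn, resUnit_transOn,
      resUnit_transOn, resUnit_transOn, resUnit_transOn, mul_mul_mul_comm, transOn_mul,
      transOn_mul]

/-- The dual of a line bundle. -/
def dual (L : LineBundle X) : LineBundle X where
  chart := L.chart
  mem_chart := L.mem_chart
  trans x y := (L.trans x y)⁻¹
  cocycle x y z W hx hy hz := by
    rw [map_inv, map_inv, map_inv, ← L.cocycle x y z W hx hy hz, mul_inv]

/-- The pullback of a line bundle along a morphism. -/
def pullback (f : Y ⟶ X) (L : LineBundle X) : LineBundle Y where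
  chart y := f ⁻¹ᵁ L.chart (f y)
  mem_chart y := L.mem_chart (f y)
  trans y z := pullUnit f (L.chart (f y) ⊓ L.chart (f z)) _ (le_preimage_inf f inf_le_left inf_le_right)
    (L.trans (f y) (f z))
  cocycle x y z W hx hy hz := by
    have e := congrArg (pullUnit f (L.chart (f x) ⊓ L.chart (f y) ⊓ L.chart (f z)) W
        (le_preimage_inf f (le_preimage_inf f hx hy) hz))
      (L.cocycle (f x) (f y) (f z) (L.chart (f x) ⊓ L.chart (f y) ⊓ L.chart (f z))
        (inf_le_left.trans inf_le_left) (inf_le_left.trans inf_le_right) inf_le_right)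
    rw [map_mul, pullUnit_resUnit, pullUnit_resUnit, pullUnit_resUnit] at e
    rw [resUnit_pullUnit, resUnit_pullUnit, resUnit_pullUnit]
    exact e

theorem transOn_trivial (x y : X) (W : X.Opens) (hx : W ≤ (trivial X).chart x)
    (hy : W ≤ (trivial X).chart y) : (trivial X).transOn x y W hx hy = 1 :=
  map_one _

theorem transOn_tensor (L M : LineBundle X) (x y : X) (W : X.Opens)
    (hx : W ≤ (L.tensor M).chart x) (hy : W ≤ (L.tensor M).chart y) :
    (L.tensor M).transOn x y W hx hy =
      L.transOn x y W (hx.trans inf_le_left) (hy.trans inf_le_left) *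
        M.transOn x y W (hx.trans inf_le_right) (hy.trans inf_le_right) :=
  (map_mul (resUnit (le_inf hx hy)) _ _).trans
    (congrArg₂ (· * ·) (resUnit_transOn L ..) (resUnit_transOn M ..))

theorem transOn_dual (L : LineBundle X) (x y : X) (W : X.Opens)
    (hx : W ≤ L.dual.chart x) (hy : W ≤ L.dual.chart y) :
    L.dual.transOn x y W hx hy = (L.transOn x y W hx hy)⁻¹ :=
  map_inv (resUnit (le_inf hx hy)) _

theorem transOn_pullback (f : Y ⟶ X) (L : LineBundle X) (x y : Y) (W : Y.Opens)
    (hx : W ≤ (L.pullback f).chart x) (hy : W ≤ (L.pullback f).chart y) :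
    (L.pullback f).transOn x y W hx hy =
      pullUnit f (L.chart (f x) ⊓ L.chart (f y)) W (le_preimage_inf f hx hy) (L.trans (f x) (f y)) :=
  resUnit_pullUnit f _ _ _

theorem pullUnit_transOn (f : Y ⟶ X) (L : LineBundle X) (x y : X) (V : X.Opens) (W : Y.Opens)
    (hx : V ≤ L.chart x) (hy : V ≤ L.chart y) (h : W ≤ f ⁻¹ᵁ V) :
    pullUnit f V W h (L.transOn x y V hx hy) =
      pullUnit f (L.chart x ⊓ L.chart y) W (h.trans (f.preimage_mono (le_inf hx hy)))
        (L.trans x y) :=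
  pullUnit_resUnit f _ _ _

/-- If the transition functions agree on common neighbourhoods, the line bundles are isomorphic. -/
theorem iso_of_eq {L M : LineBundle X}
    (H : ∀ (x y : X) (W : X.Opens) (hLx : W ≤ L.chart x) (hLy : W ≤ L.chart y)
      (hMx : W ≤ M.chart x) (hMy : W ≤ M.chart y),
      L.transOn x y W hLx hLy = M.transOn x y W hMx hMy) :
    L.Iso M :=
  ⟨fun x => L.chart x ⊓ M.chart x, fun _ => inf_le_left, fun _ => inf_le_right, fun _ => 1,
    fun x => ⟨L.mem_chart x, M.mem_chart x⟩, fun x y W hx hy => by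
      rw [map_one, map_one, one_mul, mul_one]
      exact H x y W _ _ _ _⟩

theorem tensor_congr {L L' M M' : LineBundle X} :
    L.Iso L' → M.Iso M' → (L.tensor M).Iso (L'.tensor M') := by
  rintro ⟨V, hL, hL', h, hV, H⟩ ⟨V', hM, hM', h', hV', H'⟩
  refine ⟨fun x => V x ⊓ V' x, fun x => inf_le_inf (hL x) (hM x),
    fun x => inf_le_inf (hL' x) (hM' x),
    fun x => resUnit inf_le_left (h x) * resUnit inf_le_right (h' x),
    fun x => ⟨hV x, hV' x⟩, fun x y W hx hy => ?_⟩
  have e := H x y W (hx.trans inf_le_left) (hy.trans inf_le_left)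
  have e' := H' x y W (hx.trans inf_le_right) (hy.trans inf_le_right)
  rw [map_mul, map_mul, resUnit_resUnit, resUnit_resUnit, resUnit_resUnit, resUnit_resUnit,
    transOn_tensor, transOn_tensor, mul_mul_mul_comm, e, e', mul_mul_mul_comm]

theorem dual_congr {L L' : LineBundle X} : L.Iso L' → L.dual.Iso L'.dual := by
  rintro ⟨V, hL, hL', h, hV, H⟩
  refine ⟨V, hL, hL', fun x => (h x)⁻¹, hV, fun x y W hx hy => ?_⟩
  rw [map_inv, map_inv, transOn_dual, transOn_dual, ← mul_inv, H x y W hx hy, mul_inv]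

theorem pullback_congr (f : Y ⟶ X) {L M : LineBundle X} :
    L.Iso M → (L.pullback f).Iso (M.pullback f) := by
  rintro ⟨V, hL, hM, h, hV, H⟩
  refine ⟨fun y => f ⁻¹ᵁ V (f y), fun y => f.preimage_mono (hL _),
    fun y => f.preimage_mono (hM _),
    fun y => pullUnit f _ _ le_rfl (h (f y)), fun y => hV _, fun x y W hx hy => ?_⟩
  have e := congrArg (pullUnit f (V (f x) ⊓ V (f y)) W (le_preimage_inf f hx hy))
    (H (f x) (f y) (V (f x) ⊓ V (f y)) inf_le_left inf_le_right)
  rw [map_mul, map_mul, pullUnit_resUnit, pullUnit_resUnit, pullUnit_transOn,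
    pullUnit_transOn] at e
  rw [resUnit_pullUnit, resUnit_pullUnit, transOn_pullback, transOn_pullback]
  exact e

end LineBundle

/-- The Picard group of a scheme: the group of isomorphism classes of line bundles, whose group
law, the tensor product, is written additively. -/
def Pic (X : Scheme.{u}) : Type u := Quotient (LineBundle.setoid X)

namespace Pic

variable {X Y : Scheme.{u}}

/-- The isomorphism class of a line bundle. -/
def mk (L : LineBundle X) : Pic X := Quotient.mk _ L

instance : Zero (Pic X) := ⟨mk (LineBundle.trivial X)⟩

instance : Add (Pic X) :=
  ⟨Quotient.map₂ LineBundle.tensor (fun _ _ h _ _ h' => LineBundle.tensor_congr h h')⟩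

instance : Neg (Pic X) := ⟨Quotient.map LineBundle.dual (fun _ _ h => LineBundle.dual_congr h)⟩

instance : AddCommGroup (Pic X) where
  nsmul := nsmulRec
  zsmul := zsmulRec
  add_assoc := by
    rintro ⟨L⟩ ⟨M⟩ ⟨N⟩
    refine Quotient.sound (LineBundle.iso_of_eq fun x y W _ _ _ _ => ?_)
    simp only [LineBundle.transOn_tensor, mul_assoc]
  zero_add := by
    rintro ⟨L⟩
    refine Quotient.sound (LineBundle.iso_of_eq fun x y W _ _ _ _ => ?_)
    rw [LineBundle.transOn_tensor, LineBundle.transOn_trivial, one_mul]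
  add_zero := by
    rintro ⟨L⟩
    refine Quotient.sound (LineBundle.iso_of_eq fun x y W _ _ _ _ => ?_)
    rw [LineBundle.transOn_tensor, LineBundle.transOn_trivial, mul_one]
  neg_add_cancel := by
    rintro ⟨L⟩
    refine Quotient.sound (LineBundle.iso_of_eq fun x y W _ _ _ _ => ?_)
    rw [LineBundle.transOn_tensor, LineBundle.transOn_trivial, LineBundle.transOn_dual,
      inv_mul_cancel]
  add_comm := by
    rintro ⟨L⟩ ⟨M⟩
    refine Quotient.sound (LineBundle.iso_of_eq fun x y W _ _ _ _ => ?_)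
    rw [LineBundle.transOn_tensor, LineBundle.transOn_tensor, mul_comm]

/-- Pullback of isomorphism classes of line bundles along a morphism, as a group homomorphism. -/
def pullback (f : Y ⟶ X) : Pic X →+ Pic Y where
  toFun := Quotient.map (LineBundle.pullback f) (fun _ _ h => LineBundle.pullback_congr f h)
  map_zero' := by
    refine Quotient.sound (LineBundle.iso_of_eq fun x y W _ _ _ _ => ?_)
    rw [LineBundle.transOn_pullback, LineBundle.transOn_trivial]
    exact map_one _
  map_add' := by
    rintro ⟨L⟩ ⟨M⟩
    refine Quotient.sound (LineBundle.iso_of_eq fun x y W _ _ _ _ => ?_)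
    rw [LineBundle.transOn_pullback, LineBundle.transOn_tensor, LineBundle.transOn_pullback,
      LineBundle.transOn_pullback]
    exact (map_mul (pullUnit f _ W _) _ _).trans (congrArg₂ (· * ·)
      (LineBundle.pullUnit_transOn f L ..) (LineBundle.pullUnit_transOn f M ..))

end Pic

/-- The group `Pic(X) ⊗ ℝ` of `ℝ`-line bundles on `X`. -/
abbrev RealPic (X : Scheme.{u}) : Type u := ℝ ⊗[ℤ] Pic X

/-- Pullback of `ℝ`-line bundles. -/
def RealPic.pullback {X Y : Scheme.{u}} (f : Y ⟶ X) : RealPic X →ₗ[ℝ] RealPic Y :=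
  (Pic.pullback f).toIntLinearMap.baseChange ℝ

/-! ### Projective space over a field and its line bundle `𝒪(1)` -/

section ProjectiveSpace

variable (K : Type u) [Field K] (n : ℕ)

/-- The grading by degree on the polynomial ring `K[X₀, …, Xₙ]`. -/
abbrev grading : ℕ → Submodule K (MvPolynomial (Fin (n + 1)) K) :=
  MvPolynomial.homogeneousSubmodule (Fin (n + 1)) K

instance : GradedAlgebra (grading K n) := MvPolynomial.gradedAlgebra

/-- Projective space `ℙⁿ = Proj K[X₀, …, Xₙ]` as a scheme over `K`. -/
def projectiveSpace : Over (Spec (.of K)) :=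
  Over.mk (Y := Proj (grading K n)) (Proj.toSpecZero (grading K n) ≫
    Spec.map (CommRingCat.ofHom (algebraMap K (grading K n 0))))

variable {K n}

theorem X_mem_grading (i : Fin (n + 1)) :
    (MvPolynomial.X i : MvPolynomial (Fin (n + 1)) K) ∈ grading K n 1 :=
  MvPolynomial.isHomogeneous_X K i

/-- The standard affine open subset `Xᵢ ≠ 0` of projective space. -/
def stdOpen (i : Fin (n + 1)) : (projectiveSpace K n).left.Opens :=
  Proj.basicOpen (grading K n) (MvPolynomial.X i)

theorem exists_mem_stdOpen (p : (projectiveSpace K n).left) : ∃ i, p ∈ stdOpen (K := K) i := by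
  have h : (⨆ i, Proj.basicOpen (grading K n) (MvPolynomial.X i)) = ⊤ := by
    refine Proj.iSup_basicOpen_eq_top' _ _ (fun i => ⟨1, X_mem_grading i⟩) ?_
    rw [eq_top_iff]
    intro q _
    induction q using MvPolynomial.induction_on with
    | C a =>
      exact Subalgebra.algebraMap_mem (Algebra.adjoin (grading K n 0) _)
        (⟨MvPolynomial.C a, MvPolynomial.isHomogeneous_C _ a⟩ : grading K n 0)
    | add q r hq hr => exact add_mem (hq _root_.trivial) (hr _root_.trivial)
    | mul_X q i hq => exact mul_mem (hq _root_.trivial) (Algebra.subset_adjoin ⟨i, rfl⟩)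
  exact TopologicalSpace.Opens.mem_iSup.mp (h.ge (Set.mem_univ p))

/-- A standard open subset containing a given point of projective space. -/
def chartIndex (p : (projectiveSpace K n).left) : Fin (n + 1) :=
  (exists_mem_stdOpen p).choose

theorem mem_stdOpen_chartIndex (p : (projectiveSpace K n).left) :
    p ∈ stdOpen (K := K) (chartIndex p) :=
  (exists_mem_stdOpen p).choose_spec

/-- The function `Xⱼ / Xᵢ` on the standard open subset `Xᵢ ≠ 0`. -/
def coordRatio (i j : Fin (n + 1)) : Γ((projectiveSpace K n).left, stdOpen (K := K) i) :=
  (Proj.awayToSection (grading K n) (MvPolynomial.X i)).hom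
    (HomogeneousLocalization.Away.mk (grading K n) (X_mem_grading i) 1 (MvPolynomial.X j)
      (by simpa using X_mem_grading j))

/-- The value in the local ring at `q` of the function `X_b / X_a`. -/
theorem coordRatio_res_val (a b : Fin (n + 1)) (W : (projectiveSpace K n).left.Opens)
    (h : W ≤ stdOpen a) (q : ProjectiveSpectrum (grading K n)) (hq : q ∈ W) :
    ((((projectiveSpace K n).left.presheaf.map (homOfLE h).op).hom
        (coordRatio a b)).1 ⟨q, hq⟩).val =
      IsLocalization.mk' (Localization.AtPrime q.asHomogeneousIdeal.toIdeal)
        (MvPolynomial.X b : MvPolynomial (Fin (n + 1)) K)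
        (⟨MvPolynomial.X a, h hq⟩ : q.asHomogeneousIdeal.toIdeal.primeCompl) := by
  refine (ProjectiveSpectrum.Proj.awayToSection_apply (𝒜 := grading K n) _ _ ⟨q, h hq⟩).trans ?_
  rw [HomogeneousLocalization.Away.val_mk, Localization.mk_eq_mk', IsLocalization.map_mk']
  simp only [RingHom.id_apply, pow_one]

theorem coordRatio_mul_res (i j k : Fin (n + 1)) (W : (projectiveSpace K n).left.Opens)
    (hi : W ≤ stdOpen i) (hj : W ≤ stdOpen j) :
    ((projectiveSpace K n).left.presheaf.map (homOfLE hi).op).hom (coordRatio i j) *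
      ((projectiveSpace K n).left.presheaf.map (homOfLE hj).op).hom (coordRatio j k) =
    ((projectiveSpace K n).left.presheaf.map (homOfLE hi).op).hom (coordRatio i k) := by
  apply Subtype.ext
  funext ⟨q, hq⟩
  apply HomogeneousLocalization.val_injective
  refine (HomogeneousLocalization.val_mul _ _).trans ?_
  refine (congrArg₂ (· * ·) (coordRatio_res_val i j W hi q hq)
    (coordRatio_res_val j k W hj q hq)).trans (Eq.trans ?_ (coordRatio_res_val i k W hi q hq).symm)
  simp only
  rw [← IsLocalization.mk'_mul, IsLocalization.mk'_eq_iff_eq]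
  simp only [Submonoid.coe_mul]
  congr 1
  ring

theorem coordRatio_self_res (i : Fin (n + 1)) (W : (projectiveSpace K n).left.Opens)
    (hi : W ≤ stdOpen i) :
    ((projectiveSpace K n).left.presheaf.map (homOfLE hi).op).hom (coordRatio i i) = 1 := by
  apply Subtype.ext
  funext ⟨q, hq⟩
  apply HomogeneousLocalization.val_injective
  refine (coordRatio_res_val i i W hi q hq).trans (Eq.trans ?_ HomogeneousLocalization.val_one.symm)
  exact IsLocalization.mk'_self _ (hi hq)

/-- The invertible function `Xⱼ / Xᵢ` on an open subset where neither coordinate vanishes. -/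
def coordRatioUnit (i j : Fin (n + 1)) (W : (projectiveSpace K n).left.Opens)
    (hi : W ≤ stdOpen i) (hj : W ≤ stdOpen j) : Γ((projectiveSpace K n).left, W)ˣ where
  val := ((projectiveSpace K n).left.presheaf.map (homOfLE hi).op).hom (coordRatio i j)
  inv := ((projectiveSpace K n).left.presheaf.map (homOfLE hj).op).hom (coordRatio j i)
  val_inv := by rw [coordRatio_mul_res, coordRatio_self_res]
  inv_val := by rw [coordRatio_mul_res, coordRatio_self_res]

theorem resUnit_coordRatioUnit (i j : Fin (n + 1)) {V W : (projectiveSpace K n).left.Opens}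
    (hi : V ≤ stdOpen i) (hj : V ≤ stdOpen j) (h : W ≤ V) :
    resUnit h (coordRatioUnit i j V hi hj) =
      coordRatioUnit i j W (h.trans hi) (h.trans hj) := by
  ext
  simp only [resUnit, coordRatioUnit, Units.coe_map, RingHom.toMonoidHom_eq_coe,
    MonoidHom.coe_coe]
  rw [← CommRingCat.comp_apply, ← Functor.map_comp]
  rfl

variable (K n) in
/-- The line bundle `𝒪(1)` on projective space: it is trivial on the standard open subsets, and on
`Xᵢ ≠ 0` its global section `X_k` is the function `X_k / Xᵢ`, so that the transition function from
`Xⱼ ≠ 0` to `Xᵢ ≠ 0` is `Xⱼ / Xᵢ`. -/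
def twistingSheaf : LineBundle (projectiveSpace K n).left where
  chart p := stdOpen (chartIndex p)
  mem_chart p := mem_stdOpen_chartIndex p
  trans p q := coordRatioUnit (chartIndex p) (chartIndex q) _ inf_le_left inf_le_right
  cocycle p q r W hp hq hr := by
    rw [resUnit_coordRatioUnit, resUnit_coordRatioUnit, resUnit_coordRatioUnit]
    ext
    exact coordRatio_mul_res _ _ _ W hp hq

variable (K n) in
/-- The class of `𝒪(1)` in the Picard group of projective space. -/
def twistingClass : Pic (projectiveSpace K n).left :=
  Pic.mk (twistingSheaf K n)

end ProjectiveSpace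

/-! ### Heights -/

section Heights

/-- The absolute logarithmic height of a tuple `x` of algebraic numbers, not all zero: the
logarithmic height of `x` over the number field `F` generated by its entries (the sum over all
places `v` of `F`, with multiplicities, of `log maxᵢ |xᵢ|ᵥ`), divided by `[F : ℚ]`. -/
def absLogHeight {E : Type u} [Field E] [CharZero E] [Algebra.IsAlgebraic ℚ E] {n : ℕ}
    (x : Fin n → E) : ℝ :=
  let F : IntermediateField ℚ E := IntermediateField.adjoin ℚ (Set.range x)
  haveI : NumberField F :=
    { to_charZero := inferInstance
      to_finiteDimensional := IntermediateField.finiteDimensional_adjoin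
        fun y _ => Algebra.IsIntegral.isIntegral y }
  (Module.finrank ℚ F : ℝ)⁻¹ *
    Height.logHeight (fun i => (⟨x i, IntermediateField.subset_adjoin ℚ _ ⟨i, rfl⟩⟩ : F))

variable (K : Type u) [Field K]

/-- The spectrum of an algebraic closure of `K`, as a scheme over `K`. -/
def geomPoint : Over (Spec (.of K)) :=
  Over.mk (Spec.map (CommRingCat.ofHom (algebraMap K (AlgebraicClosure K))))

variable {K}

/-- The set `X(K̄)` of points of a `K`-scheme with values in an algebraic closure of `K`. -/
abbrev GeomPoints (X : Over (Spec (.of K))) : Type u := geomPoint K ⟶ X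

/-- The value of a function at a geometric point. -/
def evalAt {X : Over (Spec (.of K))} (x : GeomPoints X) (U : X.left.Opens)
    (h : x.left (IsLocalRing.closedPoint (AlgebraicClosure K)) ∈ U) :
    Γ(X.left, U) →+* AlgebraicClosure K :=
  (x.left.appLE U ⊤ (fun y _ => by
    rw [Subsingleton.elim (α := PrimeSpectrum (AlgebraicClosure K)) y
      (IsLocalRing.closedPoint (AlgebraicClosure K))]
    exact h) ≫ (Scheme.ΓSpecIso (.of (AlgebraicClosure K))).hom).hom

/-- Homogeneous coordinates of a point `p` of `ℙⁿ(K̄)`, normalised so that some coordinate, say the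
`i`-th, is `1`: the `j`-th coordinate is the value at `p` of the function `Xⱼ / Xᵢ`. -/
def homogCoords {n : ℕ} (p : GeomPoints (projectiveSpace K n)) : Fin (n + 1) → AlgebraicClosure K :=
  fun j => evalAt p (stdOpen (chartIndex (p.left (IsLocalRing.closedPoint (AlgebraicClosure K)))))
    (mem_stdOpen_chartIndex _) (coordRatio _ j)

variable [NumberField K]

instance : Algebra.IsAlgebraic ℚ (AlgebraicClosure K) :=
  Algebra.IsAlgebraic.trans ℚ K (AlgebraicClosure K)

/-- The absolute logarithmic naive height on `ℙⁿ(K̄)`. -/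
def naiveHeight {n : ℕ} (p : GeomPoints (projectiveSpace K n)) : ℝ :=
  absLogHeight (homogCoords p)

/-- `h` is a Weil height on `X(K̄)` corresponding to the `ℝ`-line bundle `L`, that is, a
representative of the class `h_L` of functions modulo bounded functions which is determined by
`ℝ`-linearity in `L`, functoriality and the normalisation `h_{𝒪(1)} = naive height` on projective
space: for some expression `L = ∑ⱼ rⱼ • φⱼ^* 𝒪(1)` with morphisms `φⱼ` to projective spaces and real
numbers `rⱼ`, the function `h` differs from `∑ⱼ rⱼ * naiveHeight ∘ φⱼ` by a bounded function. -/
def IsWeilHeight {X : Over (Spec (.of K))} (L : RealPic X.left) (h : GeomPoints X → ℝ) : Prop :=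
  ∃ (m : ℕ) (r : Fin m → ℝ) (N : Fin m → ℕ) (φ : ∀ j, X ⟶ projectiveSpace K (N j)) (C : ℝ),
    L = ∑ j, r j ⊗ₜ[ℤ] Pic.pullback (φ j).left (twistingClass K (N j)) ∧
    ∀ x : GeomPoints X, |h x - ∑ j, r j * naiveHeight (x ≫ φ j)| ≤ C

end Heights

/-! ### Projective schemes, ampleness and dynamical systems -/

section Dynamics

variable {K : Type u} [Field K]

/-- A `K`-scheme is projective if it is isomorphic over `K` to a closed subscheme of some `ℙⁿ`. -/
def IsProjective (X : Over (Spec (.of K))) : Prop :=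
  ∃ (n : ℕ) (φ : X ⟶ projectiveSpace K n), IsClosedImmersion φ.left

/-- A line bundle on a projective `K`-scheme is very ample if it is the pullback of `𝒪(1)` under a
closed immersion into a projective space. -/
def IsVeryAmple (X : Over (Spec (.of K))) (L : Pic X.left) : Prop :=
  ∃ (n : ℕ) (φ : X ⟶ projectiveSpace K n), IsClosedImmersion φ.left ∧
    L = Pic.pullback φ.left (twistingClass K n)

/-- A line bundle on a projective `K`-scheme is ample if some positive tensor power of it is very
ample. -/
def IsAmple (X : Over (Spec (.of K))) (L : Pic X.left) : Prop :=
  ∃ m : ℕ, 0 < m ∧ IsVeryAmple X (m • L)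

/-- An `ℝ`-line bundle is ample if it is a non-empty sum of positive real multiples of ample line
bundles. -/
def IsAmpleReal (X : Over (Spec (.of K))) (L : RealPic X.left) : Prop :=
  ∃ (m : ℕ) (r : Fin (m + 1) → ℝ) (A : Fin (m + 1) → Pic X.left),
    (∀ i, 0 < r i ∧ IsAmple X (A i)) ∧ L = ∑ i, r i ⊗ₜ[ℤ] A i

variable {X : Over (Spec (.of K))} {k : ℕ}

/-- `(X; f₁, …, f_k)` is a dynamical system associated with the `ℝ`-line bundle `L` of degree `d`:
`d > k` and `∑ᵢ fᵢ^* L = d • L` in `Pic(X) ⊗ ℝ`. -/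
def IsDynamicalSystem (f : Fin k → (X ⟶ X)) (L : RealPic X.left) (d : ℝ) : Prop :=
  (k : ℝ) < d ∧ ∑ i, RealPic.pullback (f i).left L = d • L

/-- `h` is the canonical height function on `X(K̄)` associated with `L` and `f₁, …, f_k`: it is a
Weil height corresponding to `L`, and `∑ᵢ h(fᵢ(x)) = d * h(x)` for all `x`. -/
def IsCanonicalHeight [NumberField K] (f : Fin k → (X ⟶ X)) (L : RealPic X.left) (d : ℝ)
    (h : GeomPoints X → ℝ) : Prop :=
  IsWeilHeight L h ∧ ∀ x : GeomPoints X, ∑ i, h (x ≫ f i) = d * h x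

/-- The forward orbit `C(x) = {f_{i₁}(f_{i₂}(⋯ f_{i_l}(x))) | l ≥ 0}` of a geometric point. -/
def forwardOrbit (f : Fin k → (X ⟶ X)) (x : GeomPoints X) : Set (GeomPoints X) :=
  {y | ∃ w : List (Fin k), y = w.foldr (fun i z => z ≫ f i) x}

end Dynamics

end CanonicalHeight

end

/-! By ampleness, `L` is a combination with coefficients `t i > 0` of pullbacks of `𝒪(1)` under
closed immersions `ψ i`. Once `h` is known to differ from `∑ t i * naiveHeight (x ≫ ψ i)` by a
bounded function, it is bounded below and takes bounded values at only finitely many points over a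
fixed number field. As `d > k`, the functional equation then forces the infimum of `h` to be
nonnegative (`nonneg_of_sum_comp_eq`). If `h x = 0`, nonnegativity makes `h` vanish on the whole
orbit; its points are defined over one number field, so Northcott's theorem
(`finite_setOf_naiveHeight_le`) makes it finite. If the orbit is finite, a point `y` of it with `h
y` maximal satisfies `d * h y ≤ k * h y`, so `h y ≤ 0`.

The substance is that two expressions of `L` through pullbacks of `𝒪(1)` give the same height up to
a bounded function (`exists_abs_sub_le_of_sum_eq`). Their difference is a real relation between
classes `φ l ^* 𝒪(1)`, and flatness of `ℝ` over `ℤ` breaks it into integral relations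
(`exists_int_relations`). An integral relation with exponents `n l` trivialises a tensor product of
powers. For every choice `I` of one coordinate per `l` this gives a unit on the open set where these
coordinates do not vanish (`exists_units_of_sum_eq_zero`). Its value at `x` is `κ * ∏ c l (I l) ^ n
l`, where `c l` are the homogeneous coordinates of the image of `x` and `κ` does not depend on `I`
(`value_unit_eq`).

Since `X` is proper, this unit and its inverse are integral over the ring generated by the ratios of
coordinates (`exists_monic_equation`). At a place `v`, take for `I` the coordinates of maximal
absolute value. The ratios then have absolute value at most 1, and Cauchy's bound controls `log |κ|
+ ∑ n l * log max |c l|` at `v` in terms of the fixed equations only. In the sum over all places `κ`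
drops out by the product formula, and what remains is bounded through the height of the coefficients
(`abs_sum_mul_logHeight_le`), uniformly in the field of definition after division by its degree
(`exists_abs_sum_mul_logHeight_le`). -/

noncomputable section

namespace CanonicalHeight

/-! ### Heights under extension of number fields. -/

section HeightExtension

open Height NumberField

variable {F F' : Type*} [Field F] [NumberField F] [Field F'] [NumberField F'] [Algebra F F']
  {ι : Type*}

/-- The archimedean part of the height, as a product over the complex embeddings. -/
theorem prod_infinitePlace_eq_prod_embedding (x : ι → F) :
    ∏ v : InfinitePlace F, (⨆ i, v (x i)) ^ v.mult = ∏ φ : F →+* ℂ, ⨆ i, ‖φ (x i)‖ := by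
  classical
  rw [← Finset.prod_fiberwise_of_maps_to (g := InfinitePlace.mk) (t := Finset.univ)
    (fun _ _ => Finset.mem_univ _)]
  refine Finset.prod_congr rfl fun v _ => ?_
  rw [← InfinitePlace.card_filter_mk_eq v, ← Finset.prod_const]
  refine Finset.prod_congr rfl fun φ hφ => ?_
  rw [Finset.mem_filter] at hφ
  rw [← hφ.2]
  rfl

/-- With `ℂ` regarded as an `F`-algebra through `ψ`, the fibre is the set of `F`-algebra maps from
`F'` to `ℂ`; separability and algebraic closedness give their number. -/
theorem card_embedding_fiber [DecidableEq (F →+* ℂ)] (ψ : F →+* ℂ) :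
    (Finset.univ.filter fun φ : F' →+* ℂ => φ.comp (algebraMap F F') = ψ).card =
      Module.finrank F F' := by
  let := ψ.toAlgebra
  rw [← AlgHom.card F F' ℂ, ← Fintype.card_subtype]
  refine Fintype.card_congr ⟨fun φ => ⟨φ.1, fun a => DFunLike.congr_fun φ.2 a⟩,
    fun φ => ⟨φ.toRingHom, φ.comp_algebraMap⟩, fun _ => rfl, fun _ => rfl⟩

theorem prod_embedding_algebraMap (x : ι → F) :
    ∏ φ : F' →+* ℂ, ⨆ i, ‖φ (algebraMap F F' (x i))‖ =
      (∏ φ : F →+* ℂ, ⨆ i, ‖φ (x i)‖) ^ Module.finrank F F' := by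
  classical
  rw [← Finset.prod_fiberwise_of_maps_to (g := fun φ : F' →+* ℂ => φ.comp (algebraMap F F'))
    (t := Finset.univ) (fun _ _ => Finset.mem_univ _), ← Finset.prod_pow]
  refine Finset.prod_congr rfl fun ψ _ => ?_
  rw [← card_embedding_fiber (F' := F') ψ, ← Finset.prod_const]
  refine Finset.prod_congr rfl fun φ hφ => ?_
  rw [Finset.mem_filter] at hφ
  rw [← hφ.2]
  rfl

/-- For integral entries the product over finite places is the inverse of the absolute norm of the
ideal they generate, and the norm of an extended ideal is the `[F' : F]`-th power of the norm. This
avoids counting places above a given one. -/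
theorem finprod_finitePlace_algebraMap [Finite ι] {x : ι → 𝓞 F} (hx : x ≠ 0) :
    ∏ᶠ v : FinitePlace F', ⨆ i, v (algebraMap F F' (x i)) =
      (∏ᶠ v : FinitePlace F, ⨆ i, v (x i : F)) ^ Module.finrank F F' := by
  have h := absNorm_mul_finprod_finitePlace_eq_one hx
  have hx' : (fun i => algebraMap (𝓞 F) (𝓞 F') (x i)) ≠ 0 := by
    obtain ⟨i, hi⟩ := Function.ne_iff.mp hx
    refine Function.ne_iff.mpr ⟨i, ?_⟩
    simpa using hi
  have h' := absNorm_mul_finprod_finitePlace_eq_one hx'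
  have e : Ideal.span (Set.range fun i => algebraMap (𝓞 F) (𝓞 F') (x i)) =
      (Ideal.span (Set.range x)).map (algebraMap (𝓞 F) (𝓞 F')) := by
    rw [Ideal.map_span, ← Set.range_comp]
    rfl
  rw [e, Ideal.absNorm_algebraMap, ← IsFractionRing.finrank_eq (𝓞 F) F (𝓞 F') F',
    Nat.cast_pow] at h'
  have hn : (((Ideal.span (Set.range x)).absNorm : ℝ) ^ Module.finrank F F') ≠ 0 :=
    left_ne_zero_of_mul_eq_one h'
  refine mul_left_cancel₀ hn ?_
  rw [← mul_pow, h, one_pow, ← h']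
  rfl

/-- Behaviour of the height relative to a number field under an extension of number fields. -/
theorem mulHeight_algebraMap [Finite ι] (x : ι → F) :
    mulHeight (fun i => algebraMap F F' (x i)) = mulHeight x ^ Module.finrank F F' := by
  rcases eq_or_ne x 0 with rfl | hx
  · simp only [Pi.zero_apply, map_zero, mulHeight_zero, one_pow]
    exact mulHeight_zero
  cases nonempty_fintype ι
  -- Heights are invariant under scaling, so denominators may be cleared.
  obtain ⟨b, hb⟩ := IsLocalization.exist_integer_multiples_of_finite (nonZeroDivisors (𝓞 F)) x
  choose y hy using hb
  have hb0 : (algebraMap (𝓞 F) F b) ≠ 0 := by simp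
  have hyx : (fun i => (y i : F)) = (algebraMap (𝓞 F) F b) • x := by
    funext i
    exact (hy i).trans (Algebra.smul_def _ _)
  have hy0 : y ≠ 0 := by
    rintro rfl
    refine smul_ne_zero hb0 hx (hyx.symm.trans ?_)
    funext i
    simp
  have hyF : (fun i => (y i : F)) ≠ 0 := by
    rw [hyx]; exact smul_ne_zero hb0 hx
  have hyF' : (fun i => algebraMap F F' (y i)) ≠ 0 := by
    obtain ⟨i, hi⟩ := Function.ne_iff.mp hyF
    refine Function.ne_iff.mpr ⟨i, ?_⟩
    simpa using hi
  rw [← mulHeight_smul_eq_mulHeight x hb0, ← hyx,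
    ← mulHeight_smul_eq_mulHeight (fun i => algebraMap F F' (x i))
      (c := algebraMap F F' (algebraMap (𝓞 F) F b)) (by simp)]
  have e : (algebraMap F F' (algebraMap (𝓞 F) F b)) • (fun i => algebraMap F F' (x i)) =
      fun i => algebraMap F F' (y i) := by
    funext i
    rw [congrFun hyx i]
    simp
  rw [e, NumberField.mulHeight_eq hyF, NumberField.mulHeight_eq hyF', mul_pow,
    finprod_finitePlace_algebraMap hy0,
    prod_infinitePlace_eq_prod_embedding, prod_infinitePlace_eq_prod_embedding,
    prod_embedding_algebraMap]

theorem logHeight_algebraMap [Finite ι] (x : ι → F) :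
    logHeight (fun i => algebraMap F F' (x i)) = Module.finrank F F' * logHeight x := by
  rw [logHeight, mulHeight_algebraMap, Real.log_pow, logHeight]

/-- The absolute height of a tuple may be computed in any number field containing its entries. -/
theorem absLogHeight_algebraMap {E : Type u} [Field E] [CharZero E] [Algebra.IsAlgebraic ℚ E]
    [Algebra F E] {n : ℕ} (x : Fin n → F) :
    absLogHeight (fun i => algebraMap F E (x i)) =
      (Module.finrank ℚ F : ℝ)⁻¹ * logHeight x := by
  rw [absLogHeight]
  set F₀ := IntermediateField.adjoin ℚ (Set.range fun i => algebraMap F E (x i)) with hF₀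
  have : NumberField F₀ :=
    { to_charZero := inferInstance
      to_finiteDimensional := IntermediateField.finiteDimensional_adjoin
        fun y _ => Algebra.IsIntegral.isIntegral y }
  have hle : F₀ ≤ ((Algebra.ofId F E).restrictScalars ℚ).fieldRange := by
    rw [hF₀, IntermediateField.adjoin_le_iff]
    rintro _ ⟨i, rfl⟩
    exact ⟨x i, rfl⟩
  let ε : F ≃ₐ[ℚ] ((Algebra.ofId F E).restrictScalars ℚ).fieldRange :=
    AlgEquiv.ofInjectiveField ((Algebra.ofId F E).restrictScalars ℚ)
  -- The field generated by the entries embeds into `F` compatibly with `E`; the height formula for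
  -- `F` over `F₀` then cancels the degree.
  let j : F₀ →+* F := ε.symm.toAlgHom.toRingHom.comp (IntermediateField.inclusion hle).toRingHom
  have hj : ∀ y : F₀, algebraMap F E (j y) = y := fun y =>
    congrArg Subtype.val (ε.apply_symm_apply (IntermediateField.inclusion hle y))
  let := j.toAlgebra
  have e : x = fun i => algebraMap F₀ F ⟨algebraMap F E (x i),
      IntermediateField.subset_adjoin ℚ _ ⟨i, rfl⟩⟩ := by
    funext i
    exact (algebraMap F E).injective (hj ⟨_, _⟩).symm
  conv_rhs => rw [e, logHeight_algebraMap, ← Module.finrank_mul_finrank ℚ F₀ F]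
  have h1 : (Module.finrank F₀ F : ℝ) ≠ 0 := by
    have := Module.Finite.of_restrictScalars_finite ℚ F₀ F
    exact_mod_cast Module.finrank_pos.ne'
  rw [Nat.cast_mul, mul_inv, mul_assoc, inv_mul_cancel_left₀ h1]

theorem absLogHeight_nonneg {E : Type u} [Field E] [CharZero E] [Algebra.IsAlgebraic ℚ E]
    {n : ℕ} (x : Fin n → E) : 0 ≤ absLogHeight x :=
  letI F : IntermediateField ℚ E := IntermediateField.adjoin ℚ (Set.range x)
  haveI : NumberField F :=
    { to_charZero := inferInstance
      to_finiteDimensional := IntermediateField.finiteDimensional_adjoin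
        fun y _ => Algebra.IsIntegral.isIntegral y }
  mul_nonneg (by positivity) (logHeight_nonneg _)

end HeightExtension

/-! ### Combinations of heights, place by place. -/

section HeightComparison

open Height AdmissibleAbsValues

variable {F : Type*} [Field F] {ι : Type*}

theorem iSup_absoluteValue_pos [Finite ι] (v : AbsoluteValue F ℝ) {x : ι → F} (hx : x ≠ 0) :
    0 < ⨆ i, v (x i) := by
  obtain ⟨i, hi⟩ := Function.ne_iff.mp hx
  exact (v.pos hi).trans_le (Finite.le_ciSup (fun i => v (x i)) i)

variable [AdmissibleAbsValues F]

theorem finite_support_log_absoluteValue {x : F} (hx : x ≠ 0) :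
    (Function.support fun v : nonarchAbsVal (K := F) => Real.log (v.val x)).Finite := by
  refine (hasFiniteMulSupport hx).subset fun v hv hv' => hv ?_
  change v.val x = 1 at hv'
  simp [hv']

/-- Outside finitely many places all nonzero entries have absolute value 1, hence so does the
maximum. -/
theorem finite_support_log_iSup [Finite ι] {x : ι → F} (hx : x ≠ 0) :
    (Function.support fun v : nonarchAbsVal (K := F) => Real.log (⨆ i, v.val (x i))).Finite := by
  classical
  cases nonempty_fintype ι
  have hfin : (⋃ i ∈ {i | x i ≠ 0}, Function.support fun v : nonarchAbsVal (K := F) =>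
      Real.log (v.val (x i))).Finite :=
    (Set.toFinite {i | x i ≠ 0}).biUnion fun i hi => finite_support_log_absoluteValue hi
  refine hfin.subset fun v hv => ?_
  by_contra hcon
  simp only [Set.mem_ofPred_eq, Set.mem_iUnion, Function.mem_support, not_exists, not_not] at hcon
  have h1 : ∀ i, x i ≠ 0 → v.val (x i) = 1 := fun i hi =>
    Real.eq_one_of_pos_of_log_eq_zero (v.val.pos hi) (hcon i hi)
  obtain ⟨i, hi⟩ := Function.ne_iff.mp hx
  have : Nonempty ι := ⟨i⟩
  refine hv ?_
  have : ⨆ i, v.val (x i) = 1 := by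
    refine le_antisymm (ciSup_le fun j => ?_) ((h1 i hi).ge.trans
      (Finite.le_ciSup (fun i => v.val (x i)) i))
    by_cases hj : x j = 0
    · simp [hj]
    · exact (h1 j hj).le
  simp [this]

theorem logHeight_eq_sum [Finite ι] {x : ι → F} (hx : x ≠ 0) :
    logHeight x = (archAbsVal.map fun v => Real.log (⨆ i, v (x i))).sum +
      ∑ᶠ v : nonarchAbsVal (K := F), Real.log (⨆ i, v.val (x i)) := by
  have hms : (Function.mulSupport fun v : nonarchAbsVal (K := F) => ⨆ i, v.val (x i)).Finite := by
    refine (finite_support_log_iSup hx).subset fun v hv hv' => hv ?_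
    exact Real.eq_one_of_pos_of_log_eq_zero (iSup_absoluteValue_pos v.val hx) hv'
  have h1 : (archAbsVal.map fun v : AbsoluteValue F ℝ => ⨆ i, v (x i)).prod ≠ 0 := by
    rw [Ne, Multiset.prod_eq_zero_iff, Multiset.mem_map]
    rintro ⟨v, -, hv⟩
    exact (iSup_absoluteValue_pos v hx).ne' hv
  have hpos : ∀ v : nonarchAbsVal (K := F), 0 < ⨆ i, v.val (x i) :=
    fun v => iSup_absoluteValue_pos v.val hx
  rw [logHeight, mulHeight_eq hx,
    finprod_eq_prod_of_mulSupport_subset _ (s := hms.toFinset) (by simp),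
    Real.log_mul h1 (Finset.prod_pos fun v _ => hpos v).ne']
  congr 1
  · rw [Real.log_multiset_prod, Multiset.map_map]
    · rfl
    · intro y hy
      obtain ⟨v, -, rfl⟩ := Multiset.mem_map.mp hy
      exact (iSup_absoluteValue_pos v hx).ne'
  · rw [finsum_eq_sum_of_support_subset _ (s := hms.toFinset), Real.log_prod]
    · exact fun v _ => (hpos v).ne'
    · intro v hv
      simp only [Set.Finite.coe_toFinset, Function.mem_mulSupport]
      intro h
      exact hv (by simp [h])

/-- The product formula in logarithmic form. -/
theorem sum_log_absoluteValue_eq_zero {x : F} (hx : x ≠ 0) :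
    (archAbsVal.map fun v => Real.log (v x)).sum +
      ∑ᶠ v : nonarchAbsVal (K := F), Real.log (v.val x) = 0 := by
  -- A tuple with a single entry has height 0; its decomposition into local terms is the product
  -- formula.
  have h := logHeight_eq_sum (x := fun _ : Unit => x) (fun h => hx (congrFun h ()))
  rw [logHeight_eq_zero_of_subsingleton] at h
  simpa using h.symm

/-- Bound for an integral combination of heights by local estimates at all places. -/
theorem abs_sum_mul_logHeight_le [Fintype ι] {τ : ι → Type*} [∀ l, Finite (τ l)]
    (c : ∀ l, τ l → F) (hc : ∀ l, c l ≠ 0) (n : ι → ℤ) {κ : F} (hκ : κ ≠ 0)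
    {σ : Type*} [Finite σ] {b : σ → F} (hb : b ≠ 0) (D : ℝ)
    (harch : ∀ v ∈ archAbsVal (K := F),
      |Real.log (v κ) + ∑ l, n l * Real.log (⨆ i, v (c l i))| ≤
        Real.log D + Real.log (⨆ i, v (b i)))
    (hnonarch : ∀ v ∈ nonarchAbsVal (K := F),
      |Real.log (v κ) + ∑ l, n l * Real.log (⨆ i, v (c l i))| ≤ Real.log (⨆ i, v (b i))) :
    |∑ l, n l * logHeight (c l)| ≤ totalWeight F * Real.log D + logHeight b := by
  classical
  -- A finite set of places outside which all logarithms involved vanish, so that the infinite sums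
  -- can be rearranged.
  let T : Finset (nonarchAbsVal (K := F)) :=
    (Finset.univ.biUnion fun l => (finite_support_log_iSup (hc l)).toFinset) ∪
      (finite_support_log_iSup hb).toFinset ∪ (finite_support_log_absoluteValue hκ).toFinset
  have hTc : ∀ l, logHeight (c l) = (archAbsVal.map fun v => Real.log (⨆ i, v (c l i))).sum +
      ∑ v ∈ T, Real.log (⨆ i, v.val (c l i)) := fun l => by
    rw [logHeight_eq_sum (hc l), finsum_eq_sum_of_support_subset]
    intro v hv
    simp only [T, Finset.coe_union, Finset.coe_biUnion, Set.Finite.coe_toFinset]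
    exact Or.inl (Or.inl (Set.mem_biUnion (Finset.mem_coe.mpr (Finset.mem_univ l)) hv))
  have hTb : logHeight b = (archAbsVal.map fun v => Real.log (⨆ i, v (b i))).sum +
      ∑ v ∈ T, Real.log (⨆ i, v.val (b i)) := by
    rw [logHeight_eq_sum hb, finsum_eq_sum_of_support_subset]
    intro v hv
    simp only [T, Finset.coe_union, Set.Finite.coe_toFinset]
    exact Or.inl (Or.inr hv)
  have hTκ := sum_log_absoluteValue_eq_zero hκ
  rw [finsum_eq_sum_of_support_subset (s := T)] at hTκ
  swap
  · intro v hv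
    simp only [T, Finset.coe_union, Set.Finite.coe_toFinset]
    exact Or.inr hv
  have hlin : ∀ M : Multiset (AbsoluteValue F ℝ), (M.map fun v => Real.log (v κ)).sum +
      ∑ l, n l * (M.map fun v => Real.log (⨆ i, v (c l i))).sum =
      (M.map fun v => Real.log (v κ) + ∑ l, n l * Real.log (⨆ i, v (c l i))).sum := fun M => by
    induction M using Multiset.induction_on with
    | empty => simp
    | cons v M ih =>
      simp only [Multiset.map_cons, Multiset.sum_cons, mul_add, Finset.sum_add_distrib, ← ih]
      ring
  -- By the product formula, adding `log |κ|` at every place does not change the sum.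
  have key : ∑ l, n l * logHeight (c l) =
      (archAbsVal.map fun v => Real.log (v κ) + ∑ l, n l * Real.log (⨆ i, v (c l i))).sum +
      ∑ v ∈ T, (Real.log (v.val κ) + ∑ l, n l * Real.log (⨆ i, v.val (c l i))) := by
    rw [← hlin, Finset.sum_add_distrib, Finset.sum_comm]
    simp only [hTc, mul_add, Finset.sum_add_distrib, Finset.mul_sum]
    linarith
  -- Archimedean places occur with multiplicity. The cardinality of the full multiset is
  -- `totalWeight`; sub-multisets are needed for the induction.
  have harch' : ∀ M : Multiset (AbsoluteValue F ℝ), M ≤ archAbsVal →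
      |(M.map fun v => Real.log (v κ) + ∑ l, n l * Real.log (⨆ i, v (c l i))).sum| ≤
        M.card * Real.log D + (M.map fun v => Real.log (⨆ i, v (b i))).sum := fun M hM => by
    induction M using Multiset.induction_on with
    | empty => simp
    | cons v M ih =>
      have h1 := ih ((Multiset.le_cons_self M v).trans hM)
      have h2 := harch v (Multiset.mem_of_le hM (Multiset.mem_cons_self v M))
      simp only [Multiset.map_cons, Multiset.sum_cons, Multiset.card_cons, Nat.cast_add,
        Nat.cast_one]
      refine (abs_add_le _ _).trans ?_
      linarith
  have hnon' := (Finset.abs_sum_le_sum_abs (fun v : nonarchAbsVal (K := F) =>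
    Real.log (v.val κ) + ∑ l, n l * Real.log (⨆ i, v.val (c l i))) T).trans
    (Finset.sum_le_sum fun v _ => hnonarch v.val v.2)
  have h3 := harch' archAbsVal le_rfl
  rw [key, hTb]
  refine (abs_add_le _ _).trans ?_
  rw [totalWeight]
  linarith

end HeightComparison

/-! ### Bounds for roots of monic equations at one absolute value. -/

section IntegralBound

variable {F : Type*} [Field F]

/-- Cauchy's bound for the roots of a monic polynomial. -/
theorem absoluteValue_root_le (v : AbsoluteValue F ℝ) {q : ℕ} {u : F} {p : Fin q → F}
    (hu : u ^ q + ∑ t, p t * u ^ (t : ℕ) = 0) {B : ℝ} (hB : 1 ≤ B) (hp : ∑ t, v (p t) ≤ B) :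
    v u ≤ B := by
  by_contra! hlt
  have h1 : 1 ≤ v u := hB.trans hlt.le
  rcases q with _ | q
  · simp at hu
  have e : u ^ (q + 1) = -∑ t, p t * u ^ (t : ℕ) := eq_neg_of_add_eq_zero_left hu
  have h2 : v u ^ (q + 1) ≤ (∑ t, v (p t)) * v u ^ q := by
    rw [← map_pow, e, v.map_neg, Finset.sum_mul]
    refine (v.sum_le _ _).trans (Finset.sum_le_sum fun t _ => ?_)
    rw [map_mul, map_pow]
    exact mul_le_mul_of_nonneg_left (pow_le_pow_right₀ h1 (Nat.lt_succ_iff.mp t.2)) (v.nonneg _)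
  have h3 : 0 < v u ^ q := by positivity
  rw [pow_succ'] at h2
  exact absurd (le_of_mul_le_mul_right h2 h3) (not_le.mpr (hp.trans_lt hlt))

/-- One term dominates the ultrametric sum, so a bound on each coefficient suffices. A constant
factor here would be fatal, as it would occur at infinitely many places. -/
theorem absoluteValue_root_le_of_isNonarchimedean {v : AbsoluteValue F ℝ}
    (hv : IsNonarchimedean v) {q : ℕ} {u : F} {p : Fin q → F}
    (hu : u ^ q + ∑ t, p t * u ^ (t : ℕ) = 0) {B : ℝ} (hB : 1 ≤ B) (hp : ∀ t, v (p t) ≤ B) :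
    v u ≤ B := by
  by_contra! hlt
  have h1 : 1 ≤ v u := hB.trans hlt.le
  rcases q with _ | q
  · simp at hu
  have e : u ^ (q + 1) = -∑ t, p t * u ^ (t : ℕ) := eq_neg_of_add_eq_zero_left hu
  obtain ⟨t, -, ht⟩ := hv.finset_image_add_of_nonempty (fun t : Fin (q + 1) => p t * u ^ (t : ℕ))
    (Finset.univ_nonempty)
  have h2 : v u ^ (q + 1) ≤ B * v u ^ q := by
    rw [← map_pow, e, v.map_neg]
    refine ht.trans ?_
    rw [map_mul, map_pow]
    exact mul_le_mul (hp t) (pow_le_pow_right₀ h1 (Nat.lt_succ_iff.mp t.2)) (by positivity)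
      (by positivity)
  have h3 : 0 < v u ^ q := by positivity
  rw [pow_succ'] at h2
  exact absurd (le_of_mul_le_mul_right h2 h3) (not_le.mpr hlt)

variable {σ : Type*}

theorem absoluteValue_eval_le (v : AbsoluteValue F ℝ) (P : MvPolynomial σ F) {y : σ → F}
    (hy : ∀ i, v (y i) ≤ 1) {B : ℝ} (hB : ∀ m ∈ P.support, v (P.coeff m) ≤ B) :
    v (P.eval y) ≤ P.support.card * B := by
  rw [MvPolynomial.eval_eq, ← nsmul_eq_mul]
  refine (v.sum_le _ _).trans (Finset.sum_le_card_nsmul _ _ _ fun m hm => ?_)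
  rw [map_mul, map_prod]
  refine (mul_le_of_le_one_right (v.nonneg _) ?_).trans (hB m hm)
  refine Finset.prod_le_one (fun _ _ => v.nonneg _) fun i _ => ?_
  rw [map_pow]
  exact pow_le_one₀ (v.nonneg _) (hy i)

theorem absoluteValue_eval_le_of_isNonarchimedean {v : AbsoluteValue F ℝ}
    (hv : IsNonarchimedean v) (P : MvPolynomial σ F) {y : σ → F}
    (hy : ∀ i, v (y i) ≤ 1) {B : ℝ} (hB0 : 0 ≤ B) (hB : ∀ m ∈ P.support, v (P.coeff m) ≤ B) :
    v (P.eval y) ≤ B := by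
  rw [MvPolynomial.eval_eq]
  rcases P.support.eq_empty_or_nonempty with h | h
  · simpa [h] using hB0
  obtain ⟨m, hm, hle⟩ := hv.finset_image_add_of_nonempty
    (fun m => P.coeff m * ∏ i ∈ m.support, y i ^ m i) h
  refine hle.trans ?_
  rw [map_mul, map_prod]
  refine (mul_le_of_le_one_right (v.nonneg _) ?_).trans (hB m hm)
  refine Finset.prod_le_one (fun _ _ => v.nonneg _) fun i _ => ?_
  rw [map_pow]
  exact pow_le_one₀ (v.nonneg _) (hy i)

/-- A solution of a monic equation whose coefficients are polynomials evaluated at elements of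
absolute value at most one is bounded in terms of the coefficients of these polynomials. -/
theorem exists_bound_root {K : Type*} [Field K] {q : ℕ} (P : Fin q → MvPolynomial σ K) :
    ∃ (D : ℝ) (S : Finset K), 1 ≤ D ∧ 1 ∈ S ∧ ∀ (F : Type u) [Field F] [Algebra K F]
      (v : AbsoluteValue F ℝ) (y : σ → F) (u : F), (∀ i, v (y i) ≤ 1) →
      u ^ q + ∑ t, (P t).aeval y * u ^ (t : ℕ) = 0 → ∀ B : ℝ,
      (∀ s ∈ S, v (algebraMap K F s) ≤ B) → v u ≤ D * B ∧ (IsNonarchimedean v → v u ≤ B) := by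
  classical
  -- `D` counts monomials for the triangle inequality. `S` consists of the coefficients together
  -- with 1, which ensures `1 ≤ B` as Cauchy's bound requires.
  refine ⟨1 + ∑ t, ((P t).support.card : ℝ),
    insert 1 (Finset.univ.biUnion fun t => (P t).support.image (P t).coeff), ?_,
    Finset.mem_insert_self _ _, fun F _ _ v y u hy hu B hB => ?_⟩
  · have : (0 : ℝ) ≤ ∑ t, ((P t).support.card : ℝ) := by positivity
    linarith
  have hB1 : 1 ≤ B := by simpa using hB 1 (Finset.mem_insert_self _ _)
  have hcoeff : ∀ t, ∀ m ∈ ((P t).map (algebraMap K F)).support,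
      v (((P t).map (algebraMap K F)).coeff m) ≤ B := fun t m hm => by
    rw [MvPolynomial.coeff_map]
    refine hB _ (Finset.mem_insert_of_mem (Finset.mem_biUnion.mpr ⟨t, Finset.mem_univ t,
      Finset.mem_image_of_mem _ ?_⟩))
    exact MvPolynomial.support_map_subset _ _ hm
  have haeval : ∀ t, (P t).aeval y = ((P t).map (algebraMap K F)).eval y := fun t => by
    rw [MvPolynomial.eval_map, MvPolynomial.aeval_def]
  simp only [haeval] at hu
  have hS : (0 : ℝ) ≤ ∑ t, ((P t).support.card : ℝ) := by positivity
  refine ⟨absoluteValue_root_le v hu ?_ ?_, fun hv =>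
    absoluteValue_root_le_of_isNonarchimedean hv hu hB1 fun t =>
      absoluteValue_eval_le_of_isNonarchimedean hv _ hy (zero_le_one.trans hB1) (hcoeff t)⟩
  · nlinarith
  · calc ∑ t, v (((P t).map (algebraMap K F)).eval y)
        ≤ ∑ t, ((P t).support.card : ℝ) * B := Finset.sum_le_sum fun t _ =>
          (absoluteValue_eval_le v _ hy (hcoeff t)).trans (mul_le_mul_of_nonneg_right
            (by exact_mod_cast Finset.card_le_card (MvPolynomial.support_map_subset _ _))
            (zero_le_one.trans hB1))
      _ ≤ _ := by
          rw [← Finset.sum_mul]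
          nlinarith

/-- The bounds only weaken when `D` and `S` grow, so a sum and a union serve a finite family. Both
are chosen before the field and the absolute value. -/
theorem exists_bound_root_family {K : Type*} [Field K] {A : Type*} [Finite A] {q : A → ℕ}
    (P : ∀ a, Fin (q a) → MvPolynomial σ K) :
    ∃ (D : ℝ) (S : Finset K), 1 ≤ D ∧ 1 ∈ S ∧ ∀ (F : Type u) [Field F] [Algebra K F]
      (v : AbsoluteValue F ℝ) (y : σ → F) (u : F) (a : A), (∀ i, v (y i) ≤ 1) →
      u ^ q a + ∑ t, (P a t).aeval y * u ^ (t : ℕ) = 0 → ∀ B : ℝ,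
      (∀ s ∈ S, v (algebraMap K F s) ≤ B) → v u ≤ D * B ∧ (IsNonarchimedean v → v u ≤ B) := by
  classical
  cases nonempty_fintype A
  choose D S hD h1 H using fun a => exists_bound_root.{u} (P a)
  have hpos : ∀ a ∈ Finset.univ, 0 ≤ D a := fun a _ => zero_le_one.trans (hD a)
  refine ⟨1 + ∑ a, D a, insert 1 (Finset.univ.biUnion S), ?_, Finset.mem_insert_self _ _,
    fun F _ _ v y u a hy hu B hB => ?_⟩
  · linarith [Finset.sum_nonneg hpos]
  have hB1 : 1 ≤ B := by simpa using hB 1 (Finset.mem_insert_self _ _)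
  obtain ⟨e1, e2⟩ := H a F v y u hy hu B fun s hs => hB s
    (Finset.mem_insert_of_mem (Finset.mem_biUnion.mpr ⟨a, Finset.mem_univ a, hs⟩))
  refine ⟨e1.trans (mul_le_mul_of_nonneg_right ?_ (zero_le_one.trans hB1)), e2⟩
  linarith [Finset.single_le_sum hpos (Finset.mem_univ a)]

end IntegralBound

/-! ### Bounds uniform in the number field. -/

section UniformBound

open Height AdmissibleAbsValues

variable {ι : Type*} [Fintype ι] {τ : ι → Type*} [∀ l, Fintype (τ l)]

/-- Local estimate: if `κ * ∏ l, c l (I l) ^ n l` and its inverse are bounded by `B`, where `I l`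
is the index of a coordinate of maximal absolute value, then `∑ l, n l * log max |c l|` differs
from `-log |κ|` by at most `log B`. -/
theorem abs_log_add_sum_le {F : Type*} [Field F] (v : AbsoluteValue F ℝ) (c : ∀ l, τ l → F)
    (n : ι → ℤ) {κ : F} (hκ : κ ≠ 0) (I : ∀ l, τ l) (hI : ∀ l, c l (I l) ≠ 0)
    (hmax : ∀ l i, v (c l i) ≤ v (c l (I l))) {B : ℝ}
    (h1 : v (κ * ∏ l, c l (I l) ^ n l) ≤ B) (h2 : v (κ * ∏ l, c l (I l) ^ n l)⁻¹ ≤ B) :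
    |Real.log (v κ) + ∑ l, n l * Real.log (⨆ i, v (c l i))| ≤ Real.log B := by
  have hu : κ * ∏ l, c l (I l) ^ n l ≠ 0 :=
    mul_ne_zero hκ (Finset.prod_ne_zero_iff.mpr fun l _ => zpow_ne_zero _ (hI l))
  have e : Real.log (v κ) + ∑ l, n l * Real.log (⨆ i, v (c l i)) =
      Real.log (v (κ * ∏ l, c l (I l) ^ n l)) := by
    rw [map_mul, map_prod, Real.log_mul (v.ne_zero hκ), Real.log_prod]
    · congr 1
      refine Finset.sum_congr rfl fun l _ => ?_
      have : Nonempty (τ l) := ⟨I l⟩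
      rw [map_zpow₀, Real.log_zpow, le_antisymm (ciSup_le (hmax l))
        (Finite.le_ciSup (fun i => v (c l i)) (I l))]
    · exact fun l _ => v.ne_zero (zpow_ne_zero _ (hI l))
    · exact Finset.prod_ne_zero_iff.mpr fun l _ => v.ne_zero (zpow_ne_zero _ (hI l))
  rw [e, abs_le]
  have hpos := v.pos hu
  constructor
  · rw [neg_le, ← Real.log_inv, ← map_inv₀]
    exact Real.log_le_log (v.pos (inv_ne_zero hu)) h2
  · exact Real.log_le_log hpos h1

/-- Uniform bound for an integral combination of heights of tuples `c l` over varying number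
fields `F`, if the functions `κ * ∏ l, c l (I l) ^ n l` and their inverses satisfy fixed monic
equations over the polynomial ring in the `c l i / c l (I l)`. -/
theorem exists_abs_sum_mul_logHeight_le {K : Type*} [Field K] [NumberField K] (n : ι → ℤ)
    {q : (∀ l, τ l) × Bool → ℕ} (P : ∀ a, Fin (q a) → MvPolynomial (Σ l, τ l) K) :
    ∃ C : ℝ, ∀ (F : Type u) [Field F] [NumberField F] [Algebra K F] (c : ∀ l, τ l → F) (κ : F),
      κ ≠ 0 → (∀ l, c l ≠ 0) → (∀ I : ∀ l, τ l, (∀ l, c l (I l) ≠ 0) → ∀ ε : Bool,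
        let u := cond ε (κ * ∏ l, c l (I l) ^ n l) (κ * ∏ l, c l (I l) ^ n l)⁻¹
        u ^ q (I, ε) + ∑ t, (P (I, ε) t).aeval (fun i => c i.1 i.2 / c i.1 (I i.1)) *
          u ^ (t : ℕ) = 0) →
      |∑ l, n l * ((Module.finrank ℚ F : ℝ)⁻¹ * logHeight (c l))| ≤ C := by
  classical
  obtain ⟨D, S, hD, h1, H⟩ := exists_bound_root_family.{u} P
  refine ⟨Real.log D + (Module.finrank ℚ K : ℝ)⁻¹ * logHeight (fun s : S => (s : K)),
    fun F _ _ _ c κ hκ hc h => ?_⟩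
  have hb : (fun s : S => algebraMap K F s) ≠ 0 := by
    refine Function.ne_iff.mpr ⟨⟨1, h1⟩, ?_⟩
    simp
  have hD0 : D ≠ 0 := (zero_lt_one.trans_le hD).ne'
  have hS : ∀ v : AbsoluteValue F ℝ, ∀ s ∈ S,
      v (algebraMap K F s) ≤ ⨆ s : S, v (algebraMap K F s) := fun v s hs =>
    Finite.le_ciSup (fun s : S => v (algebraMap K F s)) ⟨s, hs⟩
  -- The choice `I` of largest coordinates depends on the place; finiteness of the set of possible
  -- `I` keeps `D` and `S` uniform.
  have loc : ∀ v : AbsoluteValue F ℝ, ∃ I : ∀ l, τ l, (∀ l, c l (I l) ≠ 0) ∧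
      (∀ l i, v (c l i) ≤ v (c l (I l))) ∧ ∀ l i, v (c l i / c l (I l)) ≤ 1 := fun v => by
    have hne : ∀ l, Nonempty (τ l) := fun l => (Function.ne_iff.mp (hc l)).nonempty
    choose I hI using fun l => Finite.exists_max fun i => v (c l i)
    have hI0 : ∀ l, c l (I l) ≠ 0 := fun l h0 => by
      obtain ⟨i, hi⟩ := Function.ne_iff.mp (hc l)
      have := hI l i
      rw [h0, map_zero] at this
      exact hi (v.eq_zero.mp (le_antisymm this (v.nonneg _)))
    refine ⟨I, hI0, hI, fun l i => ?_⟩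
    rw [map_div₀]
    exact div_le_one_of_le₀ (hI l i) (v.nonneg _)
  have key := abs_sum_mul_logHeight_le c hc n hκ hb D (fun v _ => by
      obtain ⟨I, hI0, hI, hI1⟩ := loc v
      rw [← Real.log_mul hD0 (iSup_absoluteValue_pos v hb).ne']
      exact abs_log_add_sum_le v c n hκ I hI0 hI
        (H F v _ _ (I, true) (fun i => hI1 i.1 i.2) (h I hI0 true) _ (hS v)).1
        (H F v _ _ (I, false) (fun i => hI1 i.1 i.2) (h I hI0 false) _ (hS v)).1)
    (fun v hv => by
      obtain ⟨I, hI0, hI, hI1⟩ := loc v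
      have hna := isNonarchimedean v hv
      exact abs_log_add_sum_le v c n hκ I hI0 hI
        ((H F v _ _ (I, true) (fun i => hI1 i.1 i.2) (h I hI0 true) _ (hS v)).2 hna)
        ((H F v _ _ (I, false) (fun i => hI1 i.1 i.2) (h I hI0 false) _ (hS v)).2 hna))
  have hQ : (0 : ℝ) < Module.finrank ℚ F := by exact_mod_cast Module.finrank_pos
  have hQK : (0 : ℝ) < Module.finrank ℚ K := by exact_mod_cast Module.finrank_pos
  have hKF : (0 : ℝ) < Module.finrank K F := by
    have := Module.Finite.of_restrictScalars_finite ℚ K F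
    exact_mod_cast Module.finrank_pos
  have e : ∑ l, n l * ((Module.finrank ℚ F : ℝ)⁻¹ * logHeight (c l)) =
      (Module.finrank ℚ F : ℝ)⁻¹ * ∑ l, n l * logHeight (c l) := by
    rw [Finset.mul_sum]
    exact Finset.sum_congr rfl fun l _ => by ring
  rw [e, abs_mul, abs_of_pos (inv_pos.mpr hQ), inv_mul_le_iff₀ hQ]
  refine key.trans (le_of_eq ?_)
  -- The archimedean weight is `[F : ℚ]`, and the height of `S` over `F` is `[F : K]` times that
  -- over `K`. Division by `[F : ℚ]` leaves a constant independent of `F`.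
  rw [NumberField.totalWeight_eq_finrank, logHeight_algebraMap,
    ← Module.finrank_mul_finrank ℚ K F]
  push_cast
  field_simp

end UniformBound

/-! ### Tensor products of integral powers as explicit cocycles. -/

section MixedPower

variable {X : Scheme.{u}} {ι : Type*} [Fintype ι]

namespace LineBundle

/-- The common chart at `x` of a finite family of line bundles. -/
def commonChart (L : ι → LineBundle X) (x : X) : X.Opens :=
  Finset.univ.inf fun l => (L l).chart x

theorem commonChart_le (L : ι → LineBundle X) (x : X) (l : ι) :
    commonChart L x ≤ (L l).chart x :=
  Finset.inf_le (f := fun l => (L l).chart x) (Finset.mem_univ l)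

/-- The tensor product of integral powers of line bundles. -/
def mixedPower (L : ι → LineBundle X) (n : ι → ℤ) : LineBundle X where
  chart := commonChart L
  mem_chart x := by
    rw [commonChart, ← SetLike.mem_coe, TopologicalSpace.Opens.coe_finset_inf]
    simpa using fun l => (L l).mem_chart x
  trans x y := ∏ l, (L l).transOn x y _ (inf_le_left.trans (commonChart_le L x l))
    (inf_le_right.trans (commonChart_le L y l)) ^ n l
  cocycle x y z W hx hy hz := by
    rw [map_prod, map_prod, map_prod, ← Finset.prod_mul_distrib]
    refine Finset.prod_congr rfl fun l _ => ?_
    rw [map_zpow, map_zpow, map_zpow, ← mul_zpow, resUnit_transOn, resUnit_transOn,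
      resUnit_transOn, transOn_mul]

theorem transOn_mixedPower (L : ι → LineBundle X) (n : ι → ℤ) (x y : X) (W : X.Opens)
    (hx : W ≤ (mixedPower L n).chart x) (hy : W ≤ (mixedPower L n).chart y) :
    (mixedPower L n).transOn x y W hx hy =
      ∏ l, (L l).transOn x y W (hx.trans (commonChart_le L x l))
        (hy.trans (commonChart_le L y l)) ^ n l := by
  refine (map_prod (resUnit (U := commonChart L x ⊓ commonChart L y) (le_inf hx hy)) _ _).trans (Finset.prod_congr rfl fun l _ => ?_)
  rw [map_zpow, resUnit_transOn]

end LineBundle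

/-- The class of a tensor product of integral powers is additive in the exponents. -/
def Pic.mixedPower (L : ι → LineBundle X) : (ι → ℤ) →+ Pic X where
  toFun n := Pic.mk (LineBundle.mixedPower L n)
  map_zero' := by
    refine Quotient.sound (LineBundle.iso_of_eq fun x y W _ _ _ _ => ?_)
    rw [LineBundle.transOn_mixedPower, LineBundle.transOn_trivial]
    simp
  map_add' n n' := by
    refine Quotient.sound (LineBundle.iso_of_eq fun x y W _ _ _ _ => ?_)
    rw [LineBundle.transOn_mixedPower, LineBundle.transOn_tensor, LineBundle.transOn_mixedPower,
      LineBundle.transOn_mixedPower]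
    simp only [Pi.add_apply, zpow_add, Finset.prod_mul_distrib]

/-- Additivity in the exponents reduces to unit vectors, for which one factor of the cocycle
survives. A relation in the Picard group thereby becomes a trivialisation of one concrete cocycle.
-/
theorem Pic.mixedPower_apply (L : ι → LineBundle X) (n : ι → ℤ) :
    Pic.mixedPower L n = ∑ l, n l • Pic.mk (L l) := by
  classical
  have h : ∀ l, Pic.mixedPower L (Pi.single l 1) = Pic.mk (L l) := fun l => by
    refine Quotient.sound (LineBundle.iso_of_eq fun x y W _ _ _ _ => ?_)
    rw [LineBundle.transOn_mixedPower, Finset.prod_eq_single l]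
    · rw [Pi.single_eq_same, zpow_one]
    · intro l' _ hl'
      rw [Pi.single_eq_of_ne hl', zpow_zero]
    · simp
  conv_lhs => rw [← Finset.univ_sum_single n]
  rw [map_sum]
  refine Finset.sum_congr rfl fun l _ => ?_
  rw [← h l, ← map_zsmul, ← Pi.single_smul, smul_eq_mul, mul_one]

end MixedPower

/-! ### Gluing invertible functions. -/

section Gluing

/-- Compatible invertible functions on neighbourhoods of all points of an open set glue. -/
theorem exists_glue_units {X : Scheme.{u}} (U : X.Opens) (V : U → X.Opens)
    (hV : ∀ p, V p ≤ U) (hmem : ∀ p : U, p.1 ∈ V p) (s : ∀ p, Γ(X, V p)ˣ)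
    (hs : ∀ (p q : U) (W : X.Opens) (hp : W ≤ V p) (hq : W ≤ V q),
      resUnit hp (s p) = resUnit hq (s q)) :
    ∃ u : Γ(X, U)ˣ, ∀ p, resUnit (hV p) u = s p := by
  have hcover : U ≤ iSup V := fun p hp => TopologicalSpace.Opens.mem_iSup.mpr ⟨⟨p, hp⟩, hmem ⟨p, hp⟩⟩
  -- The functions and their inverses are glued separately; that the product is 1 is a local
  -- statement.
  have glue : ∀ t : ∀ p, Γ(X, V p)ˣ, (∀ (p q : U) (W : X.Opens) (hp : W ≤ V p) (hq : W ≤ V q),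
      resUnit hp (t p) = resUnit hq (t q)) → ∃ a : Γ(X, U), ∀ p,
      (X.presheaf.map (homOfLE (hV p)).op).hom a = t p := fun t ht => by
    obtain ⟨a, ha, -⟩ := X.sheaf.existsUnique_gluing' V U (fun p => homOfLE (hV p)) hcover
      (fun p => (t p : Γ(X, V p))) (fun p q =>
        congrArg Units.val (ht p q (V p ⊓ V q) inf_le_left inf_le_right))
    exact ⟨a, ha⟩
  obtain ⟨a, ha⟩ := glue s hs
  obtain ⟨b, hb⟩ := glue (fun p => (s p)⁻¹) fun p q W hp hq => by
    rw [map_inv, map_inv, hs p q W hp hq]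
  have hab : a * b = 1 := by
    refine X.sheaf.eq_of_locally_eq' V U (fun p => homOfLE (hV p)) hcover _ _ fun p => ?_
    change (X.presheaf.map (homOfLE (hV p)).op).hom _ = (X.presheaf.map (homOfLE (hV p)).op).hom _
    rw [map_mul, ha, hb, map_one, Units.mul_inv]
  exact ⟨⟨a, b, hab, by rw [mul_comm, hab]⟩, fun p => Units.ext (ha p)⟩

end Gluing

/-! ### Units attached to an integral relation. -/

section Frames

variable {K : Type u} [Field K] {X : Over (Spec (.of K))} {ι : Type*} [Fintype ι] {N : ι → ℕ}

/-- The open subset of `X` where the `I l`-th homogeneous coordinate of `φ l` does not vanish for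
all `l`. -/
def coordOpen (φ : ∀ l, X ⟶ projectiveSpace K (N l)) (I : ∀ l, Fin (N l + 1)) : X.left.Opens :=
  Finset.univ.inf fun l => (φ l).left ⁻¹ᵁ stdOpen (I l)

theorem coordOpen_le (φ : ∀ l, X ⟶ projectiveSpace K (N l)) (I : ∀ l, Fin (N l + 1)) (l : ι) :
    coordOpen φ I ≤ (φ l).left ⁻¹ᵁ stdOpen (I l) :=
  Finset.inf_le (Finset.mem_univ l)

theorem mem_coordOpen_iff (φ : ∀ l, X ⟶ projectiveSpace K (N l)) (I : ∀ l, Fin (N l + 1))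
    (p : X.left) : p ∈ coordOpen φ I ↔ ∀ l, (φ l).left p ∈ stdOpen (K := K) (I l) := by
  rw [← SetLike.mem_coe, coordOpen, TopologicalSpace.Opens.coe_finset_inf]
  simp

theorem coordRatioUnit_mul {n : ℕ} (i j k : Fin (n + 1)) (W : (projectiveSpace K n).left.Opens)
    (hi : W ≤ stdOpen i) (hj : W ≤ stdOpen j) (hk : W ≤ stdOpen k) :
    coordRatioUnit i j W hi hj * coordRatioUnit j k W hj hk = coordRatioUnit i k W hi hk :=
  Units.ext (coordRatio_mul_res i j k W hi hj)

/-- The pullback of the function `X_b / X_a`. -/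
def pullRatio {n : ℕ} (φ : X ⟶ projectiveSpace K n) (a b : Fin (n + 1)) (W : X.left.Opens)
    (ha : W ≤ φ.left ⁻¹ᵁ stdOpen a) (hb : W ≤ φ.left ⁻¹ᵁ stdOpen b) : Γ(X.left, W)ˣ :=
  pullUnit φ.left (stdOpen a ⊓ stdOpen b) W (le_preimage_inf φ.left ha hb)
    (coordRatioUnit a b _ inf_le_left inf_le_right)

theorem resUnit_pullRatio {n : ℕ} (φ : X ⟶ projectiveSpace K n) (a b : Fin (n + 1))
    {V W : X.left.Opens} (ha : V ≤ φ.left ⁻¹ᵁ stdOpen a) (hb : V ≤ φ.left ⁻¹ᵁ stdOpen b)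
    (h : W ≤ V) : resUnit h (pullRatio φ a b V ha hb) =
      pullRatio φ a b W (h.trans ha) (h.trans hb) :=
  resUnit_pullUnit _ _ _ _

theorem pullRatio_mul {n : ℕ} (φ : X ⟶ projectiveSpace K n) (a b c : Fin (n + 1))
    (W : X.left.Opens) (ha : W ≤ φ.left ⁻¹ᵁ stdOpen a) (hb : W ≤ φ.left ⁻¹ᵁ stdOpen b)
    (hc : W ≤ φ.left ⁻¹ᵁ stdOpen c) :
    pullRatio φ a b W ha hb * pullRatio φ b c W hb hc = pullRatio φ a c W ha hc := by
  have e := congrArg (pullUnit φ.left (stdOpen a ⊓ stdOpen b ⊓ stdOpen c) W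
    (le_preimage_inf φ.left (le_preimage_inf φ.left ha hb) hc))
    (coordRatioUnit_mul a b c (stdOpen a ⊓ stdOpen b ⊓ stdOpen c)
      (inf_le_left.trans inf_le_left) (inf_le_left.trans inf_le_right) inf_le_right)
  rw [map_mul] at e
  rw [← resUnit_coordRatioUnit a b (V := stdOpen a ⊓ stdOpen b) inf_le_left inf_le_right
      inf_le_left,
    ← resUnit_coordRatioUnit b c (V := stdOpen b ⊓ stdOpen c) inf_le_left inf_le_right
      (le_inf (inf_le_left.trans inf_le_right) inf_le_right),
    ← resUnit_coordRatioUnit a c (V := stdOpen a ⊓ stdOpen c) inf_le_left inf_le_right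
      (le_inf (inf_le_left.trans inf_le_left) inf_le_right),
    pullUnit_resUnit, pullUnit_resUnit, pullUnit_resUnit] at e
  exact e

/-- A trivialisation of an integral combination of pullbacks of `𝒪(1)` gives invertible functions
on the open sets `coordOpen φ I`, which are locally a fixed invertible function times a product of
powers of ratios of coordinates. -/
theorem exists_units_of_sum_eq_zero (φ : ∀ l, X ⟶ projectiveSpace K (N l)) (n : ι → ℤ)
    (h : ∑ l, n l • Pic.pullback (φ l).left (twistingClass K (N l)) = 0) :
    ∃ (u : ∀ I, Γ(X.left, coordOpen φ I)ˣ) (V : X.left → X.left.Opens)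
      (hV : ∀ p l, V p ≤ (φ l).left ⁻¹ᵁ stdOpen (chartIndex ((φ l).left p)))
      (s : ∀ p, Γ(X.left, V p)ˣ), (∀ p, p ∈ V p) ∧ ∀ (I : ∀ l, Fin (N l + 1)) (p : X.left)
        (W : X.left.Opens) (hW : W ≤ coordOpen φ I) (hp : W ≤ V p), p ∈ W →
        resUnit hW (u I) = resUnit hp (s p) * ∏ l, pullRatio (φ l) (chartIndex ((φ l).left p))
          (I l) W (hp.trans (hV p l)) (hW.trans (coordOpen_le φ I l)) ^ n l := by
  have h' : Pic.mixedPower (fun l => LineBundle.pullback (φ l).left (twistingSheaf K (N l))) n =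
      Pic.mk (LineBundle.trivial X.left) := (Pic.mixedPower_apply _ n).trans h
  obtain ⟨V, hL, hM, s, hV, hs⟩ := Quotient.exact h'
  have hVφ : ∀ p l, V p ≤ (φ l).left ⁻¹ᵁ stdOpen (chartIndex ((φ l).left p)) := fun p l =>
    (hL p).trans (LineBundle.commonChart_le
      (fun l => LineBundle.pullback (φ l).left (twistingSheaf K (N l))) p l)
  have H' : ∀ (p q : X.left) (W : X.left.Opens) (hp : W ≤ V p) (hq : W ≤ V q),
      resUnit hp (s p) * ∏ l, pullRatio (φ l) (chartIndex ((φ l).left p))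
        (chartIndex ((φ l).left q)) W (hp.trans (hVφ p l)) (hq.trans (hVφ q l)) ^ n l =
      resUnit hq (s q) := fun p q W hp hq => by
    have e := hs p q W hp hq
    rw [LineBundle.transOn_trivial, one_mul, LineBundle.transOn_mixedPower] at e
    rw [← e]
    congr 1
    refine Finset.prod_congr rfl fun l _ => ?_
    rw [LineBundle.transOn_pullback]
    rfl
  -- The local expressions at `p` and `q` agree on overlaps: passing from the chart of `p` to that
  -- of `q` and then to `I` telescopes, by `H'` and `pullRatio_mul`.
  have glue : ∀ I : ∀ l, Fin (N l + 1), ∃ u : Γ(X.left, coordOpen φ I)ˣ,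
      ∀ p : coordOpen φ I, resUnit (inf_le_left : coordOpen φ I ⊓ V p.1 ≤ coordOpen φ I) u =
        resUnit (inf_le_right : coordOpen φ I ⊓ V p.1 ≤ V p.1) (s p.1) *
          ∏ l, pullRatio (φ l) (chartIndex ((φ l).left p.1)) (I l) (coordOpen φ I ⊓ V p.1)
            (inf_le_right.trans (hVφ p.1 l)) (inf_le_left.trans (coordOpen_le φ I l)) ^ n l :=
    fun I => by
    refine exists_glue_units (coordOpen φ I) (fun p => coordOpen φ I ⊓ V p.1)
      (fun p => inf_le_left) (fun p => ⟨p.2, hV p.1⟩) _ fun p q W hp hq => ?_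
    rw [map_mul, map_mul, map_prod, map_prod, resUnit_resUnit, resUnit_resUnit,
      ← H' p.1 q.1 W (hp.trans inf_le_right) (hq.trans inf_le_right), mul_assoc,
      ← Finset.prod_mul_distrib]
    congr 1
    refine Finset.prod_congr rfl fun l _ => ?_
    rw [map_zpow, map_zpow, resUnit_pullRatio, resUnit_pullRatio, ← mul_zpow, pullRatio_mul]
  choose u hu using glue
  refine ⟨u, V, hVφ, s, hV, fun I p W hW hp hpW => ?_⟩
  have e := congrArg (resUnit (le_inf hW hp)) (hu I ⟨p, hW hpW⟩)
  rw [map_mul, map_prod, resUnit_resUnit, resUnit_resUnit] at e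
  rw [e]
  congr 1
  refine Finset.prod_congr rfl fun l _ => ?_
  rw [map_zpow, resUnit_pullRatio]

end Frames

/-! ### Values of functions at geometric points. -/

section Evaluation

variable {K : Type u} [Field K] {X Y : Over (Spec (.of K))}

theorem le_preimage_top {X Y : Scheme.{u}} (f : X ⟶ Y) (V : X.Opens) : V ≤ f ⁻¹ᵁ ⊤ :=
  fun _ _ => trivial

/-- The structure map from the base field to the functions on an open set. -/
def scalar (X : Over (Spec (.of K))) (U : X.left.Opens) : K →+* Γ(X.left, U) :=
  ((Scheme.ΓSpecIso (.of K)).inv ≫ Scheme.Hom.appLE (Y := Spec (.of K)) X.hom ⊤ U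
    (le_preimage_top X.hom U)).hom

theorem appLE_scalar (φ : X ⟶ Y) (U : Y.left.Opens) (V : X.left.Opens)
    (h : V ≤ φ.left ⁻¹ᵁ U) (a : K) : (φ.left.appLE U V h).hom (scalar Y U a) = scalar X V a := by
  rw [scalar, scalar, ← RingHom.comp_apply, ← CommRingCat.hom_comp, Category.assoc,
    Scheme.Hom.appLE_comp_appLE]
  congr 4
  exact Over.w φ

theorem res_scalar (U V : X.left.Opens) (h : V ≤ U) (a : K) :
    (X.left.presheaf.map (homOfLE h).op).hom (scalar X U a) = scalar X V a := by
  rw [scalar, scalar, ← RingHom.comp_apply, ← CommRingCat.hom_comp, Category.assoc,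
    Scheme.Hom.appLE_map]

/-- A geometric point as a morphism of schemes. -/
def geomHom (x : GeomPoints X) : Spec (.of (AlgebraicClosure K)) ⟶ X.left := x.left

variable (K) in
/-- The unique point of the spectrum of the algebraic closure. -/
def geomOrigin : Spec (.of (AlgebraicClosure K)) :=
  IsLocalRing.closedPoint (AlgebraicClosure K)

/-- The image of a geometric point. -/
def geomImage (x : GeomPoints X) : X.left := geomHom x (geomOrigin K)

theorem eq_geomOrigin (y : Spec (.of (AlgebraicClosure K))) : y = geomOrigin K :=
  Subsingleton.elim (α := PrimeSpectrum (AlgebraicClosure K)) y _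

theorem top_le_preimage_geomHom (x : GeomPoints X) {U : X.left.Opens} (hx : geomImage x ∈ U) :
    ⊤ ≤ geomHom x ⁻¹ᵁ U := fun y _ => by
  rw [eq_geomOrigin y]
  exact hx

/-- The value of a function at a geometric point. -/
def value (x : GeomPoints X) (U : X.left.Opens) (hx : geomImage x ∈ U) :
    Γ(X.left, U) →+* AlgebraicClosure K :=
  ((geomHom x).appLE U ⊤ (top_le_preimage_geomHom x hx) ≫
    (Scheme.ΓSpecIso (.of (AlgebraicClosure K))).hom).hom

theorem value_res (x : GeomPoints X) {U V : X.left.Opens} (h : V ≤ U) (hx : geomImage x ∈ V)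
    (a : Γ(X.left, U)) : value x V hx ((X.left.presheaf.map (homOfLE h).op).hom a) =
      value x U (h hx) a := by
  rw [value, value, ← RingHom.comp_apply, ← CommRingCat.hom_comp, Scheme.Hom.map_appLE_assoc]

theorem value_appLE (x : GeomPoints X) (φ : X ⟶ Y) (U : Y.left.Opens) (V : X.left.Opens)
    (h : V ≤ φ.left ⁻¹ᵁ U) (hx : geomImage x ∈ V) (a : Γ(Y.left, U)) :
    value x V hx ((φ.left.appLE U V h).hom a) = value (x ≫ φ) U (h hx) a := by
  rw [value, ← RingHom.comp_apply, ← CommRingCat.hom_comp, ← Category.assoc,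
    Scheme.Hom.appLE_comp_appLE]
  rfl

theorem value_scalar (x : GeomPoints X) (U : X.left.Opens) (hx : geomImage x ∈ U) (a : K) :
    value x U hx (scalar X U a) = algebraMap K (AlgebraicClosure K) a := by
  have hw : geomHom x ≫ X.hom = Spec.map (CommRingCat.ofHom
    (algebraMap K (AlgebraicClosure K))) := Over.w x
  have h1 : (scalar X U a) = (Scheme.Hom.appLE (Y := Spec (.of K)) X.hom ⊤ U
    (le_preimage_top X.hom U)).hom ((Scheme.ΓSpecIso (.of K)).inv.hom a) := rfl
  rw [h1, value, ← RingHom.comp_apply, ← CommRingCat.hom_comp, ← Category.assoc,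
    Scheme.Hom.appLE_comp_appLE]
  have h2 : Scheme.Hom.appLE (Y := Spec (.of K)) (geomHom x ≫ X.hom) ⊤ ⊤ (le_preimage_top _ ⊤) =
      (Spec.map (CommRingCat.ofHom (algebraMap K (AlgebraicClosure K)))).appTop := by
    rw [hw]
    exact Scheme.Hom.appLE_eq_app _
  change ((Scheme.Hom.appLE (Y := Spec (.of K)) (geomHom x ≫ X.hom) ⊤ ⊤ (le_preimage_top _ ⊤) ≫
    _).hom) _ = _
  rw [h2, Scheme.ΓSpecIso_naturality, ← RingHom.comp_apply, ← CommRingCat.hom_comp,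
    Iso.inv_hom_id_assoc]
  rfl

/-- A nonzero value is a unit of the field, so the basic open set pulls back to the whole one-point
spectrum. -/
theorem mem_basicOpen_of_value_ne_zero (x : GeomPoints X) (U : X.left.Opens)
    (hx : geomImage x ∈ U) (a : Γ(X.left, U)) (ha : value x U hx a ≠ 0) :
    geomImage x ∈ X.left.basicOpen a := by
  have h1 : IsUnit (((geomHom x).appLE U ⊤ (top_le_preimage_geomHom x hx)).hom a) :=
    (isUnit_map_iff (Scheme.ΓSpecIso (.of (AlgebraicClosure K))).commRingCatIsoToRingEquiv _).mp
      ha.isUnit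
  have h2 := Scheme.basicOpen_appLE (geomHom x) ⊤ U (top_le_preimage_geomHom x hx) a
  have h3 : geomOrigin K ∈ (Spec (.of (AlgebraicClosure K))).basicOpen
      (((geomHom x).appLE U ⊤ (top_le_preimage_geomHom x hx)).hom a) := by
    rw [Scheme.basicOpen_of_isUnit _ h1]
    trivial
  exact (h2.le h3).2

/-- A ring hom sends values of polynomials to values of polynomials. -/
theorem value_eval₂ {σ : Type*} (x : GeomPoints X) (U : X.left.Opens) (hx : geomImage x ∈ U)
    (P : MvPolynomial σ K) (y : σ → Γ(X.left, U)) :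
    value x U hx (P.eval₂ (scalar X U) y) = P.aeval (fun i => value x U hx (y i)) := by
  rw [MvPolynomial.aeval_def, MvPolynomial.hom_eval₂]
  congr 1
  ext a
  exact value_scalar x U hx a

end Evaluation

/-! ### Functions and coordinates on the standard charts of projective space. -/

section ProjectiveCoordinates

variable {K : Type u} [Field K] {n : ℕ}

/-- In the local ring at `q` the fraction `X_j / X_i` is a unit exactly when `X_j` is not in the
prime `q`. -/
theorem mem_stdOpen_of_isUnit_res (i j : Fin (n + 1)) (W : (projectiveSpace K n).left.Opens)
    (h : W ≤ stdOpen i) (q : (projectiveSpace K n).left) (hq : q ∈ W)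
    (hu : IsUnit (((projectiveSpace K n).left.presheaf.map (homOfLE h).op).hom
      (coordRatio i j))) : q ∈ stdOpen (K := K) j := by
  obtain ⟨b, hb⟩ := hu.exists_right_inv
  let q' : ProjectiveSpectrum (grading K n) := q
  have hval := congrArg (fun s => (s.1 ⟨q', hq⟩).val) hb
  have h1 : IsUnit (IsLocalization.mk' (Localization.AtPrime q'.asHomogeneousIdeal.toIdeal)
      (MvPolynomial.X j : MvPolynomial (Fin (n + 1)) K)
      (⟨MvPolynomial.X i, h hq⟩ : q'.asHomogeneousIdeal.toIdeal.primeCompl)) := by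
    refine IsUnit.of_mul_eq_one (b.1 ⟨q', hq⟩).val ?_
    rw [← coordRatio_res_val i j W h q' hq]
    exact (HomogeneousLocalization.val_mul _ _).symm.trans
      (hval.trans HomogeneousLocalization.val_one)
  rw [IsLocalization.AtPrime.isUnit_mk'_iff _ q'.asHomogeneousIdeal.toIdeal] at h1
  exact h1

theorem basicOpen_coordRatio_le (i j : Fin (n + 1)) :
    (projectiveSpace K n).left.basicOpen (coordRatio i j) ≤ stdOpen (K := K) j := fun q hq =>
  mem_stdOpen_of_isUnit_res i j _ (Scheme.basicOpen_le _ _) q hq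
    (RingedSpace.isUnit_res_basicOpen _ _)

theorem homogCoords_chartIndex (p : GeomPoints (projectiveSpace K n)) :
    homogCoords p (chartIndex (geomImage p)) = 1 := by
  have h := coordRatio_self_res (K := K) (chartIndex (geomImage p))
    (stdOpen (chartIndex (geomImage p))) le_rfl
  have h' := congrArg (value p _ (mem_stdOpen_chartIndex (geomImage p))) h
  rw [map_one, value_res p le_rfl (mem_stdOpen_chartIndex (geomImage p))] at h'
  exact h'

theorem homogCoords_ne_zero (p : GeomPoints (projectiveSpace K n)) : homogCoords p ≠ 0 :=
  fun h => one_ne_zero ((homogCoords_chartIndex p).symm.trans (congrFun h _))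

theorem mem_stdOpen_of_homogCoords_ne_zero (p : GeomPoints (projectiveSpace K n))
    (i : Fin (n + 1)) (h : homogCoords p i ≠ 0) : geomImage p ∈ stdOpen (K := K) i :=
  basicOpen_coordRatio_le _ _ (mem_basicOpen_of_value_ne_zero p
    (stdOpen (chartIndex (geomImage p))) (mem_stdOpen_chartIndex _) _ h)

theorem value_coordRatio_mul (p : GeomPoints (projectiveSpace K n)) (i j k : Fin (n + 1))
    (hi : geomImage p ∈ stdOpen (K := K) i) (hj : geomImage p ∈ stdOpen (K := K) j) :
    value p (stdOpen i) hi (coordRatio i j) * value p (stdOpen j) hj (coordRatio j k) =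
      value p (stdOpen i) hi (coordRatio i k) := by
  have hij : geomImage p ∈ stdOpen (K := K) i ⊓ stdOpen j := ⟨hi, hj⟩
  have h := congrArg (value p (stdOpen i ⊓ stdOpen j) hij)
    (coordRatio_mul_res i j k (stdOpen i ⊓ stdOpen j) inf_le_left inf_le_right)
  rw [map_mul, value_res, value_res, value_res] at h
  exact h

theorem value_coordRatio (p : GeomPoints (projectiveSpace K n)) (i j : Fin (n + 1))
    (hi : geomImage p ∈ stdOpen (K := K) i) :
    value p (stdOpen i) hi (coordRatio i j) = homogCoords p j / homogCoords p i := by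
  have hc := mem_stdOpen_chartIndex (geomImage p)
  have h := value_coordRatio_mul p _ i j hc hi
  have h1 := value_coordRatio_mul p _ i (chartIndex (geomImage p)) hc hi
  -- By `h1`, this coordinate divides the one normalised to 1.
  have h2 : homogCoords p i ≠ 0 := fun h0 => by
    have h3 : homogCoords p i * _ = homogCoords p (chartIndex (geomImage p)) := h1
    rw [h0, zero_mul, homogCoords_chartIndex] at h3
    exact zero_ne_one h3
  rw [eq_div_iff h2, mul_comm]
  exact h

/-- The scalars on a standard affine open subset of projective space. -/
theorem scalar_stdOpen (i : Fin (n + 1)) (a : K) :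
    scalar (projectiveSpace K n) (stdOpen i) a =
      (Proj.awayToSection (grading K n) (MvPolynomial.X i)).hom
        (HomogeneousLocalization.fromZeroRingHom (grading K n) _
          (algebraMap K (grading K n 0) a)) := by
  let U : (Proj (grading K n)).Opens := Proj.basicOpen (grading K n) (MvPolynomial.X i)
  let z := CommRingCat.ofHom (HomogeneousLocalization.fromZeroRingHom (grading K n)
    (Submonoid.powers (MvPolynomial.X i)))
  let c := CommRingCat.ofHom (algebraMap K (grading K n 0))
  have h1 : U.ι ≫ Proj.toSpecZero (grading K n) =
      Proj.basicOpenToSpec (grading K n) (MvPolynomial.X i) ≫ Spec.map z := by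
    rw [← Proj.awayι_toSpecZero (grading K n) _ (X_mem_grading i) one_pos, Proj.awayι,
      ← Proj.basicOpenIsoSpec_hom (grading K n) _ (X_mem_grading i) one_pos]
    simp [U]
  have h2 : U.ι ≫ (Proj.toSpecZero (grading K n) ≫ Spec.map c) =
      Proj.basicOpenToSpec (grading K n) (MvPolynomial.X i) ≫ Spec.map (c ≫ z) := by
    rw [Spec.map_comp, ← Category.assoc, h1, Category.assoc]
  have hU : (⊤ : U.toScheme.Opens) ≤ U.ι ⁻¹ᵁ U := fun y _ => y.2
  -- The factorisation `h2` of the structure morphism is read on global functions of `U`; afterwards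
  -- the isomorphism `U.topIso.inv` is cancelled.
  have h3 : (Scheme.ΓSpecIso (.of K)).inv ≫
      (Proj.toSpecZero (grading K n) ≫ Spec.map c).appLE ⊤ U (le_preimage_top _ U) ≫
        U.ι.appLE U ⊤ hU = (c ≫ z) ≫ Proj.awayToSection (grading K n) (MvPolynomial.X i) ≫
          U.topIso.inv := by
    rw [Scheme.Hom.appLE_comp_appLE]
    have : (U.ι ≫ (Proj.toSpecZero (grading K n) ≫ Spec.map c)).appLE ⊤ ⊤ (le_preimage_top _ ⊤) =
        (Proj.basicOpenToSpec (grading K n) (MvPolynomial.X i) ≫ Spec.map (c ≫ z)).appTop := by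
      rw [h2]
      exact Scheme.Hom.appLE_eq_app _
    rw [this, Scheme.Hom.comp_appTop, Scheme.Hom.appTop, Scheme.Hom.appTop,
      Proj.basicOpenToSpec_app_top, ← Scheme.Hom.appTop, Scheme.ΓSpecIso_naturality_assoc]
    simp [U]
  have h4 : U.ι.appLE U ⊤ hU = U.topIso.inv := by
    rw [Scheme.Opens.ι_appLE, Scheme.Opens.topIso_inv]
    rfl
  rw [h4, ← Category.assoc, ← Category.assoc, cancel_mono] at h3
  exact DFunLike.congr_fun (congrArg CommRingCat.Hom.hom h3) a

/-- Used with `t = 1 / X_i`, for the dehomogenisation of `P / X_i ^ m`. -/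
theorem eval₂_mul_of_isHomogeneous {R S σ : Type*} [CommSemiring R] [CommSemiring S]
    {P : MvPolynomial σ R} {m : ℕ} (hP : P.IsHomogeneous m) (g : R →+* S) (t : S) (y : σ → S) :
    P.eval₂ g (fun j => t * y j) = t ^ m * P.eval₂ g y := by
  rw [MvPolynomial.eval₂_eq, MvPolynomial.eval₂_eq, Finset.mul_sum]
  refine Finset.sum_congr rfl fun d hd => ?_
  have hdeg : ∑ j ∈ d.support, d j = m := by
    simpa [Finsupp.weight_apply, Finsupp.sum] using hP (MvPolynomial.mem_support_iff.mp hd)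
  simp only [mul_pow, Finset.prod_mul_distrib, Finset.prod_pow_eq_pow_sum, hdeg]
  ring

/-- The functions on a standard affine open subset of projective space are the polynomials in the
ratios of coordinates. -/
theorem exists_eq_eval₂_coordRatio (i : Fin (n + 1))
    (a : Γ((projectiveSpace K n).left, stdOpen (K := K) i)) :
    ∃ P : MvPolynomial (Fin (n + 1)) K,
      a = P.eval₂ (scalar (projectiveSpace K n) (stdOpen i)) (coordRatio i) := by
  obtain ⟨b, rfl⟩ : ∃ b, (Proj.awayToSection (grading K n) (MvPolynomial.X i)).hom b = a :=
    ⟨_, DFunLike.congr_fun (congrArg CommRingCat.Hom.hom (Proj.basicOpenIsoAway (grading K n) _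
      (X_mem_grading i) one_pos).inv_hom_id) a⟩
  obtain ⟨m, P, hP, rfl⟩ := HomogeneousLocalization.Away.mk_surjective (grading K n)
    (X_mem_grading i) b
  refine ⟨P, ?_⟩
  have h1 : scalar (projectiveSpace K n) (stdOpen i) =
      ((Proj.awayToSection (grading K n) (MvPolynomial.X i)).hom.comp
        ((HomogeneousLocalization.fromZeroRingHom (grading K n) _).comp
          (algebraMap K (grading K n 0)))) := RingHom.ext (scalar_stdOpen i)
  have h2 : (coordRatio (K := K) i) = fun j =>
    (Proj.awayToSection (grading K n) (MvPolynomial.X i)).hom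
      (HomogeneousLocalization.Away.mk (grading K n) (X_mem_grading i) 1 (MvPolynomial.X j)
        (by simpa using X_mem_grading j)) := rfl
  rw [h1, h2]
  refine Eq.trans ?_ (MvPolynomial.hom_eval₂ _ _ _ _)
  congr 1
  -- The identity is checked in the full localisation at `X_i`, where homogeneity of `P` gives `P /
  -- X_i ^ m = P(X_0 / X_i, …, X_n / X_i)`.
  apply HomogeneousLocalization.val_injective
  rw [HomogeneousLocalization.Away.val_mk]
  have hP' : P.IsHomogeneous m := by simpa using hP
  let A := MvPolynomial (Fin (n + 1)) K
  let R := Localization.Away (MvPolynomial.X i : A)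
  let t : R := Localization.mk 1 ⟨MvPolynomial.X i, 1, pow_one _⟩
  refine Eq.trans ?_ (MvPolynomial.hom_eval₂ P _ (algebraMap (HomogeneousLocalization.Away
    (grading K n) (MvPolynomial.X i)) R) _).symm
  have h3 : (algebraMap (HomogeneousLocalization.Away (grading K n) (MvPolynomial.X i)) R).comp
      ((HomogeneousLocalization.fromZeroRingHom (grading K n) _).comp
        (algebraMap K (grading K n 0))) = (algebraMap A R).comp MvPolynomial.C := by
    ext a
    simp [HomogeneousLocalization.fromZeroRingHom]
    rfl
  have h4 : ∀ j, algebraMap (HomogeneousLocalization.Away (grading K n) (MvPolynomial.X i)) R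
      (HomogeneousLocalization.Away.mk (grading K n) (X_mem_grading i) 1 (MvPolynomial.X j)
        (by simpa using X_mem_grading j)) = t * algebraMap A R (MvPolynomial.X j) := fun j => by
    rw [HomogeneousLocalization.algebraMap_apply, HomogeneousLocalization.Away.val_mk,
      ← Localization.mk_one_eq_algebraMap, Localization.mk_mul]
    simp
  rw [h3]
  simp only [h4]
  have h5 : Localization.mk P ⟨(MvPolynomial.X i : A) ^ m, by use m⟩ = t ^ m * algebraMap A R P := by
    rw [← Localization.mk_one_eq_algebraMap, Localization.mk_pow, Localization.mk_mul]
    simp only [one_pow, one_mul, mul_one]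
    rfl
  rw [h5, eval₂_mul_of_isHomogeneous hP']
  congr 1
  refine Eq.trans ?_ (MvPolynomial.hom_eval₂ P MvPolynomial.C (algebraMap A R) MvPolynomial.X)
  rw [MvPolynomial.eval₂_eta]

end ProjectiveCoordinates

/-! ### Integrality from universal closedness. -/

section Integrality

/-- The map from `U ×_Y V` to `U ×_S V` is a closed immersion because `Y` is separated over `S`, and
the map on to `Z ×_S V` is a base change of `g`. Their composite is universally closed and factors
as `w` followed by the separated map `t`, which can be cancelled. -/
theorem universallyClosed_of_isPullback {U' U Y S Z V W : Scheme.{u}} {p : U' ⟶ U} {q : U' ⟶ V}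
    {f : U ⟶ Y} {j : V ⟶ Y} (H : IsPullback p q f j) (y : Y ⟶ S) [IsSeparated y] (g : U ⟶ Z)
    [UniversallyClosed g] (z : Z ⟶ S) (hz : g ≫ z = f ≫ y) (w : U' ⟶ W) (a : W ⟶ Z)
    [IsSeparated a] (b : W ⟶ V) (ha : w ≫ a = p ≫ g) (hb : w ≫ b = q)
    (hab : a ≫ z = b ≫ j ≫ y) : UniversallyClosed w := by
  let t : W ⟶ Limits.pullback z (j ≫ y) := Limits.pullback.lift a b hab
  have : IsSeparated (t ≫ Limits.pullback.fst z (j ≫ y)) := by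
    rw [Limits.pullback.lift_fst]; infer_instance
  have : IsSeparated t := IsSeparated.of_comp t (Limits.pullback.fst z (j ≫ y))
  let m := Limits.pullback.map (f ≫ y) (j ≫ y) z (j ≫ y) g (𝟙 _) (𝟙 _) (by simp [hz]) (by simp)
  have hm : UniversallyClosed m :=
    MorphismProperty.pullbackMap (P := @UniversallyClosed) ‹_› (inferInstance) hz.symm
      (Category.id_comp _).symm
  have e : w ≫ t = H.isoPullback.hom ≫ Limits.pullback.mapDesc f j y ≫ m := by
    apply Limits.pullback.hom_ext
    · rw [Category.assoc, Category.assoc, Category.assoc, Limits.pullback.lift_fst,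
        Limits.pullback.lift_fst, Limits.pullback.lift_fst_assoc, Category.assoc,
        H.isoPullback_hom_fst_assoc, ha, Category.id_comp]
    · rw [Category.assoc, Category.assoc, Category.assoc, Limits.pullback.lift_snd,
        Limits.pullback.lift_snd, Limits.pullback.lift_snd_assoc, Category.assoc,
        H.isoPullback_hom_snd_assoc, hb, Category.comp_id, Category.comp_id]
  have : UniversallyClosed (w ≫ t) := by
    rw [e]; infer_instance
  exact UniversallyClosed.of_comp_of_isSeparated w t

variable {K : Type u} [Field K]

theorem toSpecΓ_scalar (X : Over (Spec (.of K))) (U : X.left.Opens) :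
    U.toSpecΓ ≫ Spec.map (CommRingCat.ofHom (scalar X U)) = U.ι ≫ X.hom := by
  have h : CommRingCat.ofHom (scalar X U) = (Scheme.ΓSpecIso (.of K)).inv ≫
    Scheme.Hom.appLE (Y := Spec (.of K)) X.hom ⊤ U (le_preimage_top X.hom U) := rfl
  rw [h, Spec.map_comp, Scheme.Opens.toSpecΓ_SpecMap_appLE_assoc, Scheme.Opens.toSpecΓ_top,
    Category.assoc, ← SpecMap_ΓSpecIso_hom, ← Spec.map_comp, Iso.inv_hom_id, Spec.map_id,
    Category.comp_id, Scheme.Hom.resLE_comp_ι]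

theorem fromSpec_comp_hom (Y : Over (Spec (.of K))) {V : Y.left.Opens} (hV : IsAffineOpen V) :
    hV.fromSpec ≫ Y.hom = Spec.map (CommRingCat.ofHom (scalar Y V)) := by
  have : IsAffine V.toScheme := hV
  rw [← cancel_epi hV.isoSpec.hom, IsAffineOpen.isoSpec_hom, toSpecΓ_scalar, ← Category.assoc,
    IsAffineOpen.toSpecΓ_fromSpec]

/-- Two squares are pasted, one intersecting two open sets and one restricting `f` over `V`; then
`V` is replaced by the spectrum of its functions. -/
theorem isPullback_inf_preimage {X Y : Scheme.{u}} (f : X ⟶ Y) (U : X.Opens) (V : Y.Opens)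
    (hV : IsAffineOpen V) :
    IsPullback (X.homOfLE (inf_le_right : f ⁻¹ᵁ V ⊓ U ≤ U))
      ((f ⁻¹ᵁ V ⊓ U).toSpecΓ ≫ Spec.map (f.appLE V (f ⁻¹ᵁ V ⊓ U) inf_le_left))
      (U.ι ≫ f) hV.fromSpec := by
  have h1 := (isPullback_opens_inf (f ⁻¹ᵁ V) U).flip
  have h2 := (isPullback_morphismRestrict f V).flip
  have h3 := h1.paste_vert h2
  have : IsAffine V.toScheme := hV
  refine h3.of_iso (Iso.refl _) (Iso.refl _) hV.isoSpec (Iso.refl _) ?_ ?_ ?_ ?_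
  · simp
  · simp [IsAffineOpen.isoSpec_hom, Scheme.Hom.resLE]
  · simp
  · rw [Iso.refl_hom, Category.comp_id, IsAffineOpen.isoSpec_hom, IsAffineOpen.toSpecΓ_fromSpec]

variable {X : Over (Spec (.of K))} {ι : Type*} {Y : ι → Over (Spec (.of K))}

/-- The subring of functions generated by the scalars and by pullbacks of functions along some
morphisms. -/
def pulledBackFunctions (φ : ∀ l, X ⟶ Y l) (V : ∀ l, (Y l).left.Opens) (s : Finset ι)
    (U : X.left.Opens) (hU : ∀ l ∈ s, U ≤ (φ l).left ⁻¹ᵁ V l) : Subring Γ(X.left, U) :=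
  Subring.closure (Set.range (scalar X U) ∪
    {b | ∃ (l : ι) (hl : l ∈ s) (a : Γ((Y l).left, V l)),
      b = ((φ l).left.appLE (V l) U (hU l hl)).hom a})

/-- Induction on `s`. A new index `l` replaces `U` by its fibre product with `V l` over `Y l`, while
the new ring receives maps from the old ring and from the functions on `V l`; this is the situation
of `universallyClosed_of_isPullback`. -/
theorem universallyClosed_toSpec_pulledBackFunctions [UniversallyClosed X.hom]
    [∀ l, IsSeparated (Y l).hom] (φ : ∀ l, X ⟶ Y l) (V : ∀ l, (Y l).left.Opens)
    (hV : ∀ l, IsAffineOpen (V l)) (s : Finset ι) :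
    ∀ (U : X.left.Opens) (_ : U = s.inf fun l => (φ l).left ⁻¹ᵁ V l)
      (hle : ∀ l ∈ s, U ≤ (φ l).left ⁻¹ᵁ V l),
      UniversallyClosed (U.toSpecΓ ≫
        Spec.map (CommRingCat.ofHom (pulledBackFunctions φ V s U hle).subtype)) := by
  classical
  induction s using Finset.induction_on with
  | empty =>
    intro U hU hle
    rw [Finset.inf_empty] at hU
    subst hU
    let B := pulledBackFunctions φ V ∅ ⊤ hle
    let c : K →+* B := (scalar X ⊤).codRestrict B fun a =>
      Subring.subset_closure (Or.inl ⟨a, rfl⟩)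
    have e : (Scheme.Opens.toSpecΓ ⊤ ≫ Spec.map (CommRingCat.ofHom B.subtype)) ≫
        Spec.map (CommRingCat.ofHom c) = (⊤ : X.left.Opens).ι ≫ X.hom := by
      rw [Category.assoc, ← Spec.map_comp, ← toSpecΓ_scalar]
      rfl
    -- Without indices the open set is all of `X`. Universal closedness over `K` passes to the map
    -- to `Spec B`, since `Spec B` is separated over `K`.
    have h1 : UniversallyClosed ((Scheme.Opens.toSpecΓ ⊤ ≫ Spec.map (CommRingCat.ofHom B.subtype)) ≫
        Spec.map (CommRingCat.ofHom c)) := by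
      have : IsIso (⊤ : X.left.Opens).ι := inferInstanceAs (IsIso X.left.topIso.hom)
      rw [e]
      infer_instance
    exact UniversallyClosed.of_comp_of_isSeparated _ (Spec.map (CommRingCat.ofHom c))
  | insert l s hl ih =>
    intro U' hU' hle'
    rw [Finset.inf_insert] at hU'
    subst hU'
    set U := s.inf fun l => (φ l).left ⁻¹ᵁ V l with hU
    set U' := (φ l).left ⁻¹ᵁ V l ⊓ U with hU'
    have hle : ∀ l ∈ s, U ≤ (φ l).left ⁻¹ᵁ V l := fun l hl =>
      Finset.inf_le (f := fun l => (φ l).left ⁻¹ᵁ V l) hl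
    have hUU : U' ≤ U := inf_le_right
    let B := pulledBackFunctions φ V s U hle
    let B' := pulledBackFunctions φ V (insert l s) U' hle'
    have := ih U rfl hle
    let r := (X.left.presheaf.map (homOfLE hUU).op).hom
    have hr : B ≤ B'.comap r := by
      refine Subring.closure_le.mpr ?_
      rintro _ (⟨a, rfl⟩ | ⟨i, hi, a, rfl⟩)
      · exact Subring.subset_closure (Or.inl ⟨a, (res_scalar U U' hUU a).symm⟩)
      · refine Subring.subset_closure (Or.inr ⟨i, Finset.mem_insert_of_mem hi, a, ?_⟩)
        rw [← RingHom.comp_apply, ← CommRingCat.hom_comp, Scheme.Hom.appLE_map]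
    let ρ : B →+* B' := (r.comp B.subtype).codRestrict B' fun b => hr b.2
    let t := ((φ l).left.appLE (V l) U' inf_le_left).hom
    let τ : Γ((Y l).left, V l) →+* B' := t.codRestrict B' fun a =>
      Subring.subset_closure (Or.inr ⟨l, Finset.mem_insert_self _ _, a, rfl⟩)
    let c : K →+* B := (scalar X U).codRestrict B fun a =>
      Subring.subset_closure (Or.inl ⟨a, rfl⟩)
    refine universallyClosed_of_isPullback
      (isPullback_inf_preimage (φ l).left U (V l) (hV l)) (Y l).hom
      (U.toSpecΓ ≫ Spec.map (CommRingCat.ofHom B.subtype)) (Spec.map (CommRingCat.ofHom c)) ?_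
      (U'.toSpecΓ ≫ Spec.map (CommRingCat.ofHom B'.subtype)) (Spec.map (CommRingCat.ofHom ρ))
      (Spec.map (CommRingCat.ofHom τ)) ?_ ?_ ?_
    · rw [Category.assoc, ← Spec.map_comp, Category.assoc, Over.w (φ l), ← toSpecΓ_scalar]
      rfl
    · rw [Category.assoc, ← Spec.map_comp, ← Category.assoc,
        ← Scheme.Opens.toSpecΓ_SpecMap_presheaf_map, Category.assoc, ← Spec.map_comp]
      rfl
    · rw [Category.assoc, ← Spec.map_comp]
      rfl
    · rw [fromSpec_comp_hom, ← Spec.map_comp, ← Spec.map_comp]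
      congr 1
      ext a
      exact (res_scalar U U' hUU a).trans (appLE_scalar (φ l) (V l) U' inf_le_left a).symm

/-- A universally closed morphism to an affine scheme is integral on global functions; the rest
identifies these with `B` and `Γ(X, U)`. -/
theorem isIntegral_of_universallyClosed_toSpec {X : Scheme.{u}} (U : X.Opens)
    (B : Subring Γ(X, U))
    [UniversallyClosed (U.toSpecΓ ≫ Spec.map (CommRingCat.ofHom B.subtype))] :
    B.subtype.IsIntegral := by
  have h := isIntegral_appTop_of_universallyClosed
    (U.toSpecΓ ≫ Spec.map (CommRingCat.ofHom B.subtype))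
  rw [Scheme.Hom.comp_appTop, Scheme.Opens.toSpecΓ_appTop, Scheme.ΓSpecIso_naturality_assoc] at h
  have h2 : (U.topIso.inv.hom.comp B.subtype).IsIntegral :=
    RingHom.IsIntegral.tower_top (Scheme.ΓSpecIso (.of B)).hom.hom _ h
  exact RingHom.IsIntegral.tower_bot _ _
    (ConcreteCategory.injective_of_mono_of_preservesPullback U.topIso.inv) h2

end Integrality

/-! ### Properness of projective schemes. -/

section Proper

variable (K : Type u) [Field K] (n : ℕ)

/-- `Proj` is proper over the spectrum of the degree-zero part, and `K` surjects onto that part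
because homogeneous polynomials of degree 0 are constant. -/
instance isProper_projectiveSpace_hom : IsProper (projectiveSpace K n).hom := by
  have : IsScalarTower K (grading K n 0) (MvPolynomial (Fin (n + 1)) K) :=
    IsScalarTower.of_algebraMap_eq (R := K) (S := grading K n 0)
      (A := MvPolynomial (Fin (n + 1)) K) fun a => rfl
  have : Algebra.FiniteType (grading K n 0) (MvPolynomial (Fin (n + 1)) K) :=
    Algebra.FiniteType.of_restrictScalars_finiteType K _ _
  have hs : Function.Surjective (algebraMap K (grading K n 0)) := fun p => by
    obtain ⟨p, hp⟩ := p
    refine ⟨p.coeff 0, Subtype.ext ?_⟩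
    exact (MvPolynomial.totalDegree_eq_zero_iff_eq_C.mp
      (Nat.le_zero.mp (MvPolynomial.IsHomogeneous.totalDegree_le hp))).symm
  have : IsClosedImmersion (Spec.map (CommRingCat.ofHom (algebraMap K (grading K n 0)))) :=
    IsClosedImmersion.spec_of_surjective _ hs
  exact inferInstanceAs (IsProper (Proj.toSpecZero (grading K n) ≫
    Spec.map (CommRingCat.ofHom (algebraMap K (grading K n 0)))))

variable {K n}

theorem IsProjective.isProper {X : Over (Spec (.of K))} (hX : IsProjective X) :
    IsProper X.hom := by
  obtain ⟨n, φ, hφ⟩ := hX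
  rw [← Over.w φ]
  infer_instance

theorem isAffineOpen_stdOpen (i : Fin (n + 1)) : IsAffineOpen (stdOpen (K := K) i) :=
  Proj.isAffineOpen_basicOpen (grading K n) _ (X_mem_grading i) one_pos

end Proper

/-! ### Monic equations over the ratios of coordinates. -/

section MonicEquation

variable {K : Type u} [Field K] {X : Over (Spec (.of K))} {ι : Type*} [Fintype ι] {N : ι → ℕ}

/-- The pullback of the function `X_j / X_i` to an open set mapping to `X_i ≠ 0`. -/
def pullCoord {n : ℕ} (φ : X ⟶ projectiveSpace K n) (U : X.left.Opens) (i : Fin (n + 1))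
    (h : U ≤ φ.left ⁻¹ᵁ stdOpen i) (j : Fin (n + 1)) : Γ(X.left, U) :=
  (φ.left.appLE (stdOpen i) U h).hom (coordRatio i j)

theorem exists_eq_eval₂_pullCoord {n : ℕ} (φ : X ⟶ projectiveSpace K n) (U : X.left.Opens)
    (i : Fin (n + 1)) (h : U ≤ φ.left ⁻¹ᵁ stdOpen i)
    (a : Γ((projectiveSpace K n).left, stdOpen (K := K) i)) :
    ∃ P : MvPolynomial (Fin (n + 1)) K,
      (φ.left.appLE (stdOpen i) U h).hom a = P.eval₂ (scalar X U) (pullCoord φ U i h) := by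
  obtain ⟨P, rfl⟩ := exists_eq_eval₂_coordRatio i a
  refine ⟨P, ?_⟩
  rw [MvPolynomial.hom_eval₂]
  congr 1
  ext a
  exact appLE_scalar φ _ _ h a

theorem pulledBackFunctions_le (φ : ∀ l, X ⟶ projectiveSpace K (N l))
    (I : ∀ l, Fin (N l + 1)) (U : X.left.Opens)
    (hU : ∀ l ∈ Finset.univ, U ≤ (φ l).left ⁻¹ᵁ stdOpen (I l)) :
    pulledBackFunctions (Y := fun l => projectiveSpace K (N l)) φ (fun l => stdOpen (I l))
      Finset.univ U hU ≤ (MvPolynomial.eval₂Hom (scalar X U) (fun i : Σ l, Fin (N l + 1) =>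
        pullCoord (φ i.1) U (I i.1) (hU i.1 (Finset.mem_univ i.1)) i.2)).range := by
  refine Subring.closure_le.mpr ?_
  rintro _ (⟨a, rfl⟩ | ⟨l, -, a, rfl⟩)
  · exact ⟨MvPolynomial.C a, MvPolynomial.eval₂_C _ _ a⟩
  · obtain ⟨P, hP⟩ := exists_eq_eval₂_pullCoord (φ l) U (I l) (hU l (Finset.mem_univ l)) a
    refine ⟨MvPolynomial.rename (fun j => ⟨l, j⟩) P, ?_⟩
    rw [MvPolynomial.coe_eval₂Hom, MvPolynomial.eval₂_rename]
    exact hP.symm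

/-- Each coefficient of an integral equation is lifted to a polynomial in the generators. The
resulting `P t` are fixed once for all points at which the equation is later evaluated. -/
theorem exists_monic_eq_of_isIntegral {R S σ : Type*} [CommRing R] [CommRing S] {g : R →+* S}
    {y : σ → S} {B : Subring S} (hB : B ≤ (MvPolynomial.eval₂Hom g y).range)
    {u : S} (hu : B.subtype.IsIntegralElem u) :
    ∃ (q : ℕ) (P : Fin q → MvPolynomial σ R),
      u ^ q + ∑ t, (P t).eval₂ g y * u ^ (t : ℕ) = 0 := by
  obtain ⟨p, hp, hpu⟩ := hu
  choose P hP using fun t : Fin p.natDegree => hB (p.coeff t).2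
  refine ⟨p.natDegree, P, ?_⟩
  rw [← hpu, Polynomial.eval₂_eq_sum_range, Finset.sum_range_succ, add_comm]
  congr 1
  · rw [Finset.sum_range]
    exact Finset.sum_congr rfl fun t _ => congrArg (· * u ^ (t : ℕ)) (hP t)
  · rw [Polynomial.Monic.coeff_natDegree hp, map_one, one_mul]

theorem isIntegral_pulledBackFunctions [UniversallyClosed X.hom]
    (φ : ∀ l, X ⟶ projectiveSpace K (N l)) (I : ∀ l, Fin (N l + 1)) :
    (pulledBackFunctions (Y := fun l => projectiveSpace K (N l)) φ (fun l => stdOpen (I l))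
      Finset.univ (coordOpen φ I) (fun l _ => coordOpen_le φ I l)).subtype.IsIntegral := by
  let V : ∀ l, (projectiveSpace K (N l)).left.Opens := fun l => stdOpen (I l)
  have hV : ∀ l, IsAffineOpen (V l) := fun l => isAffineOpen_stdOpen (I l)
  have hsep : ∀ l, IsSeparated (projectiveSpace K (N l)).hom := fun l => inferInstance
  have hU : coordOpen φ I = Finset.univ.inf fun l => (φ l).left ⁻¹ᵁ stdOpen (I l) := rfl
  have hle : ∀ l ∈ Finset.univ, coordOpen φ I ≤ (φ l).left ⁻¹ᵁ stdOpen (I l) :=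
    fun l _ => coordOpen_le φ I l
  have hc := universallyClosed_toSpec_pulledBackFunctions (X := X)
    (Y := fun l => projectiveSpace K (N l)) φ V hV Finset.univ
    (coordOpen φ I) hU hle
  exact @isIntegral_of_universallyClosed_toSpec X.left (coordOpen φ I) _ hc

/-- On the common domain of standard charts of morphisms from a proper scheme to projective
spaces, every function is integral over the ring generated by the ratios of coordinates. -/
theorem exists_monic_equation [UniversallyClosed X.hom]
    (φ : ∀ l, X ⟶ projectiveSpace K (N l)) (I : ∀ l, Fin (N l + 1))
    (u : Γ(X.left, coordOpen φ I)) :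
    ∃ (q : ℕ) (P : Fin q → MvPolynomial (Σ l, Fin (N l + 1)) K),
      u ^ q + ∑ t, (P t).eval₂ (scalar X (coordOpen φ I)) (fun i : Σ l, Fin (N l + 1) =>
        pullCoord (φ i.1) (coordOpen φ I) (I i.1) (coordOpen_le φ I i.1) i.2) * u ^ (t : ℕ) = 0 := by
  have h1 := pulledBackFunctions_le φ I (coordOpen φ I) (fun l _ => coordOpen_le φ I l)
  have h2 := isIntegral_pulledBackFunctions φ I u
  have h3 := exists_monic_eq_of_isIntegral h1 h2
  exact h3

end MonicEquation

/-! ### Fields of definition of geometric points. -/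

section FieldOfDefinition

variable {K : Type u} [Field K] {X : Over (Spec (.of K))}

/-- The values at a geometric point of all functions defined near its image lie in a finite
extension of the base field. -/
theorem exists_finiteDimensional_value_mem [LocallyOfFiniteType X.hom] (x : GeomPoints X) :
    ∃ F : IntermediateField K (AlgebraicClosure K), FiniteDimensional K F ∧
      ∀ (U : X.left.Opens) (hx : geomImage x ∈ U) (a : Γ(X.left, U)), value x U hx a ∈ F := by
  obtain ⟨V, hV, hxV, -⟩ := exists_isAffineOpen_mem_and_subset (x := geomImage x)
    (U := ⊤) trivial
  have hft : (scalar X V).FiniteType := by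
    have h1 := Scheme.Hom.finiteType_appLE (Y := Spec (.of K)) X.hom (isAffineOpen_top _) hV
      (le_preimage_top X.hom V)
    exact h1.comp (RingHom.FiniteType.of_surjective _
      (Scheme.ΓSpecIso (.of K)).commRingCatIsoToRingEquiv.symm.surjective)
  let := (scalar X V).toAlgebra
  have : Algebra.FiniteType K Γ(X.left, V) := hft
  let ev : Γ(X.left, V) →ₐ[K] AlgebraicClosure K :=
    { value x V hxV with commutes' := fun a => value_scalar x V hxV a }
  obtain ⟨S, hS⟩ := (Algebra.FiniteType.out : (⊤ : Subalgebra K Γ(X.left, V)).FG)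
  -- The values of finitely many algebra generators on one affine neighbourhood generate the field.
  let F := IntermediateField.adjoin K (ev '' S)
  have hF : ∀ a : Γ(X.left, V), value x V hxV a ∈ F := fun a => by
    have h1 : a ∈ (F.toSubalgebra.comap ev) := by
      have : (⊤ : Subalgebra K Γ(X.left, V)) ≤ F.toSubalgebra.comap ev := by
        rw [← hS, Algebra.adjoin_le_iff]
        exact fun s hs => IntermediateField.subset_adjoin _ _ ⟨s, hs, rfl⟩
      exact this trivial
    exact h1
  refine ⟨F, IntermediateField.finiteDimensional_adjoin fun y _ =>
    Algebra.IsIntegral.isIntegral y, fun U hx a => ?_⟩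
  -- On a smaller basic open set every function is a fraction `c / f ^ m` of functions on `V`, so
  -- its value is a quotient of elements of `F`.
  obtain ⟨f, hfU, hf⟩ := hV.exists_basicOpen_le (V := U) ⟨geomImage x, hx⟩ hxV
  have hres : value x U hx a = value x (X.left.basicOpen f) hf
      ((X.left.presheaf.map (homOfLE hfU).op).hom a) := (value_res x hfU hf a).symm
  rw [hres]
  generalize (X.left.presheaf.map (homOfLE hfU).op).hom a = b
  have := hV.isLocalization_basicOpen f
  obtain ⟨⟨c, s, hs⟩, hc⟩ := IsLocalization.surj (Submonoid.powers f) b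
  obtain ⟨m, rfl⟩ := hs
  have hres2 : ∀ c : Γ(X.left, V), value x (X.left.basicOpen f) hf
      (algebraMap Γ(X.left, V) Γ(X.left, X.left.basicOpen f) c) = value x V hxV c := fun c =>
    value_res x (X.left.basicOpen_le f) hf c
  have h2 := congrArg (value x (X.left.basicOpen f) hf) hc
  rw [map_mul, hres2, hres2] at h2
  have h3 : value x V hxV (f ^ m) ≠ 0 := by
    have : IsUnit (algebraMap Γ(X.left, V) Γ(X.left, X.left.basicOpen f) (f ^ m)) :=
      IsLocalization.map_units _ (⟨f ^ m, m, rfl⟩ : Submonoid.powers f)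
    rw [← hres2]
    exact (this.map _).ne_zero
  rw [eq_div_of_mul_eq h3 h2]
  exact div_mem (hF _) (hF _)

end FieldOfDefinition

/-! ### Integral relations between naive heights. -/

section IntegralRelations

variable {K : Type u} [Field K] {X : Over (Spec (.of K))} {ι : Type} [Fintype ι] {N : ι → ℕ}

theorem value_pullCoord (x : GeomPoints X) {n : ℕ} (φ : X ⟶ projectiveSpace K n)
    (U : X.left.Opens) (i : Fin (n + 1)) (h : U ≤ φ.left ⁻¹ᵁ stdOpen i) (j : Fin (n + 1))
    (hx : geomImage x ∈ U) : value x U hx (pullCoord φ U i h j) =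
      homogCoords (x ≫ φ) j / homogCoords (x ≫ φ) i :=
  (value_appLE x φ (stdOpen i) U h hx _).trans (value_coordRatio (x ≫ φ) i j (h hx))

theorem value_pullRatio (x : GeomPoints X) {n : ℕ} (φ : X ⟶ projectiveSpace K n)
    (a b : Fin (n + 1)) (W : X.left.Opens) (ha : W ≤ φ.left ⁻¹ᵁ stdOpen a)
    (hb : W ≤ φ.left ⁻¹ᵁ stdOpen b) (hx : geomImage x ∈ W) :
    value x W hx (pullRatio φ a b W ha hb : Γ(X.left, W)) =
      homogCoords (x ≫ φ) b / homogCoords (x ≫ φ) a := by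
  refine (value_appLE x φ (stdOpen a ⊓ stdOpen b) W (le_preimage_inf φ.left ha hb) hx _).trans ?_
  refine Eq.trans ?_ (value_coordRatio (x ≫ φ) a b (ha hx))
  exact value_res (x ≫ φ) _ _ _

/-- The homogeneous coordinates of the image of a geometric point lie in any field containing the
values of functions at that point. -/
theorem homogCoords_comp_mem {F : IntermediateField K (AlgebraicClosure K)} {x : GeomPoints X}
    (hF : ∀ (U : X.left.Opens) (hx : geomImage x ∈ U) (a : Γ(X.left, U)), value x U hx a ∈ F)
    {n : ℕ} (φ : X ⟶ projectiveSpace K n) (j : Fin (n + 1)) : homogCoords (x ≫ φ) j ∈ F := by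
  have h := value_pullCoord x φ _ (chartIndex (geomImage (x ≫ φ))) le_rfl j
    (mem_stdOpen_chartIndex (geomImage (x ≫ φ)))
  rw [homogCoords_chartIndex, div_one] at h
  rw [← h]
  exact hF _ _ _

/-- At its own point `x` the chart coordinate is normalised to 1, so each ratio reduces to a single
coordinate. The factor coming from `s` is the same for all `I`. -/
theorem value_unit_eq {φ : ∀ l, X ⟶ projectiveSpace K (N l)} {n : ι → ℤ}
    {I : ∀ l, Fin (N l + 1)} (x : GeomPoints X) {u : Γ(X.left, coordOpen φ I)ˣ}
    {V : X.left.Opens} {s : Γ(X.left, V)ˣ}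
    (hV : ∀ l, V ≤ (φ l).left ⁻¹ᵁ stdOpen (chartIndex ((φ l).left (geomImage x))))
    (hxV : geomImage x ∈ V) (hx : geomImage x ∈ coordOpen φ I)
    (hu : resUnit inf_le_left u = resUnit inf_le_right s *
      ∏ l, pullRatio (φ l) (chartIndex ((φ l).left (geomImage x))) (I l) (coordOpen φ I ⊓ V)
        (inf_le_right.trans (hV l)) (inf_le_left.trans (coordOpen_le φ I l)) ^ n l) :
    value x _ hx (u : Γ(X.left, coordOpen φ I)) =
      value x _ hxV (s : Γ(X.left, V)) * ∏ l, homogCoords (x ≫ φ l) (I l) ^ n l := by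
  have hW : geomImage x ∈ coordOpen φ I ⊓ V := ⟨hx, hxV⟩
  have h := congrArg (fun v => (Units.map (value x _ hW).toMonoidHom v : AlgebraicClosure K)) hu
  simp only [map_mul, map_prod, map_zpow, Units.val_mul, Units.coe_prod,
    Units.val_zpow_eq_zpow_val] at h
  refine (value_res x inf_le_left hW _).symm.trans (h.trans ?_)
  congr 1
  · exact value_res x inf_le_right hW _
  · refine Finset.prod_congr rfl fun l _ => congrArg (· ^ n l) ?_
    refine (value_pullRatio x (φ l) _ _ _ _ _ hW).trans ?_
    rw [show chartIndex ((φ l).left (geomImage x)) = chartIndex (geomImage (x ≫ φ l)) from rfl,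
      homogCoords_chartIndex, div_one]

theorem value_monic_equation {φ : ∀ l, X ⟶ projectiveSpace K (N l)} {I : ∀ l, Fin (N l + 1)}
    (x : GeomPoints X) (hx : geomImage x ∈ coordOpen φ I) {u : Γ(X.left, coordOpen φ I)}
    {q : ℕ} {P : Fin q → MvPolynomial (Σ l, Fin (N l + 1)) K}
    (h : u ^ q + ∑ t, (P t).eval₂ (scalar X (coordOpen φ I)) (fun i : Σ l, Fin (N l + 1) =>
        pullCoord (φ i.1) (coordOpen φ I) (I i.1) (coordOpen_le φ I i.1) i.2) * u ^ (t : ℕ) = 0) :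
    value x _ hx u ^ q + ∑ t, (P t).aeval (fun i : Σ l, Fin (N l + 1) =>
      homogCoords (x ≫ φ i.1) i.2 / homogCoords (x ≫ φ i.1) (I i.1)) *
        value x _ hx u ^ (t : ℕ) = 0 := by
  have h' := congrArg (value x _ hx) h
  simp only [map_add, map_pow, map_sum, map_mul, map_zero, value_eval₂, value_pullCoord] at h'
  exact h'

theorem naiveHeight_eq [NumberField K] {F : IntermediateField K (AlgebraicClosure K)}
    [NumberField F] {n : ℕ} {p : GeomPoints (projectiveSpace K n)} (c : Fin (n + 1) → F)
    (hc : ∀ j, homogCoords p j = c j) :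
    naiveHeight p = (Module.finrank ℚ F : ℝ)⁻¹ * Height.logHeight c := by
  rw [← absLogHeight_algebraMap (E := AlgebraicClosure K), naiveHeight]
  exact congrArg absLogHeight (funext hc)

/-- An integral linear relation between pullbacks of `𝒪(1)` gives the same relation, up to bounded
functions, between the pullbacks of the naive height. -/
theorem exists_abs_sum_mul_naiveHeight_le [NumberField K] [IsProper X.hom]
    (φ : ∀ l, X ⟶ projectiveSpace K (N l)) (n : ι → ℤ)
    (h : ∑ l, n l • Pic.pullback (φ l).left (twistingClass K (N l)) = 0) :
    ∃ C : ℝ, ∀ x : GeomPoints X, |∑ l, (n l : ℝ) * naiveHeight (x ≫ φ l)| ≤ C := by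
  obtain ⟨u, V, hV, s, hVmem, hu⟩ := exists_units_of_sum_eq_zero φ n h
  -- The Boolean selects the unit or its inverse: upper bounds for both are needed to bound the
  -- logarithm in absolute value.
  choose q P hP using fun a : (∀ l, Fin (N l + 1)) × Bool =>
    exists_monic_equation φ a.1 ((cond a.2 (u a.1) (u a.1)⁻¹ : Γ(X.left, coordOpen φ a.1)ˣ) :
      Γ(X.left, coordOpen φ a.1))
  obtain ⟨C, hC⟩ := exists_abs_sum_mul_logHeight_le (K := K) n P
  refine ⟨C, fun x => ?_⟩
  obtain ⟨F, hFin, hF⟩ := exists_finiteDimensional_value_mem x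
  have : NumberField F := NumberField.of_module_finite K F
  let c : ∀ l, Fin (N l + 1) → F := fun l j => ⟨_, homogCoords_comp_mem hF (φ l) j⟩
  let κ : F := ⟨value x _ (hVmem (geomImage x)) (s (geomImage x) : Γ(X.left, _)), hF _ _ _⟩
  have hκ : κ ≠ 0 := fun h0 =>
    ((s (geomImage x)).isUnit.map (value x _ (hVmem (geomImage x)))).ne_zero
      (congrArg Subtype.val h0)
  have hc : ∀ l, c l ≠ 0 := fun l h0 => homogCoords_ne_zero (x ≫ φ l)
    (funext fun j => congrArg Subtype.val (congrFun h0 j))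
  have key := hC F c κ hκ hc fun I hI ε => by
    have hx : geomImage x ∈ coordOpen φ I := (mem_coordOpen_iff φ I _).mpr fun l =>
      mem_stdOpen_of_homogCoords_ne_zero (x ≫ φ l) (I l) fun h0 => hI l (Subtype.ext h0)
    have hval := value_unit_eq x (hV (geomImage x)) (hVmem _) hx
      (hu I (geomImage x) _ inf_le_left inf_le_right ⟨hx, hVmem _⟩)
    have heq := value_monic_equation x hx (hP (I, ε))
    have hcast : value x _ hx ((cond ε (u I) (u I)⁻¹ : Γ(X.left, coordOpen φ I)ˣ) :
        Γ(X.left, coordOpen φ I)) = algebraMap F (AlgebraicClosure K)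
          (cond ε (κ * ∏ l, c l (I l) ^ n l) (κ * ∏ l, c l (I l) ^ n l)⁻¹) := by
      have h1 : value x _ hx (u I : Γ(X.left, coordOpen φ I)) =
          algebraMap F (AlgebraicClosure K) (κ * ∏ l, c l (I l) ^ n l) := by
        rw [hval, map_mul, map_prod]
        simp only [map_zpow₀]
        rfl
      cases ε
      · refine Eq.trans ?_ (map_inv₀ (algebraMap F (AlgebraicClosure K)) _).symm
        rw [← h1]
        exact eq_inv_of_mul_eq_one_left (by rw [← map_mul]; simp)
      · exact h1
    -- The equation is known in the algebraic closure and descends to `F`.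
    apply FaithfulSMul.algebraMap_injective F (AlgebraicClosure K)
    simp only [hcast] at heq
    simp only [map_add, map_pow, map_sum, map_mul, map_zero, ← MvPolynomial.aeval_algebraMap_apply]
    exact heq
  simpa only [naiveHeight_eq (c _) fun _ => rfl] using key

end IntegralRelations

/-! ### Real relations between naive heights. -/

section RealRelations

/-- A real linear relation between elements of an abelian group is a combination of integral
linear relations. -/
theorem exists_int_relations {A ι : Type*} [AddCommGroup A] [Fintype ι] {t : ι → ℝ} {a : ι → A}
    (h : ∑ l, t l ⊗ₜ[ℤ] a l = 0) :
    ∃ (k : ℕ) (n : ι → Fin k → ℤ) (y : Fin k → ℝ),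
      (∀ l, t l = ∑ j, (n l j : ℝ) * y j) ∧ ∀ j, ∑ l, n l j • a l = 0 := by
  have h' : ∑ l, a l ⊗ₜ[ℤ] t l = 0 := by
    simpa [map_sum] using congrArg (TensorProduct.comm ℤ ℝ A) h
  -- Equational criterion for the vanishing of a sum of tensors, applicable because `ℝ` is flat over
  -- `ℤ`.
  obtain ⟨k, n, y, hy, hn⟩ := vanishesTrivially_of_sum_tmul_eq_zero_of_rTensor_injective ℤ
    (Module.Flat.rTensor_preserves_injective_linearMap (M := ℝ) _
      (Submodule.injective_subtype _)) h'
  exact ⟨k, n, y, by simpa only [zsmul_eq_mul] using hy, hn⟩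

variable {K : Type u} [Field K] [NumberField K] {X : Over (Spec (.of K))} {ι : Type} [Fintype ι]
  {N : ι → ℕ}

/-- A real linear relation between pullbacks of `𝒪(1)` gives the same relation, up to bounded
functions, between the pullbacks of the naive height. -/
theorem exists_abs_real_sum_mul_naiveHeight_le [IsProper X.hom]
    (φ : ∀ l, X ⟶ projectiveSpace K (N l)) (t : ι → ℝ)
    (h : ∑ l, t l ⊗ₜ[ℤ] Pic.pullback (φ l).left (twistingClass K (N l)) = 0) :
    ∃ C : ℝ, ∀ x : GeomPoints X, |∑ l, t l * naiveHeight (x ≫ φ l)| ≤ C := by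
  obtain ⟨k, n, y, hy, hn⟩ := exists_int_relations h
  choose C hC using fun j => exists_abs_sum_mul_naiveHeight_le φ (fun l => n l j) (hn j)
  refine ⟨∑ j, |y j| * C j, fun x => ?_⟩
  have : ∑ l, t l * naiveHeight (x ≫ φ l) =
      ∑ j, y j * ∑ l, (n l j : ℝ) * naiveHeight (x ≫ φ l) := by
    simp only [hy, Finset.sum_mul, Finset.mul_sum]
    rw [Finset.sum_comm]
    exact Finset.sum_congr rfl fun j _ => Finset.sum_congr rfl fun l _ => by ring
  rw [this]
  refine (Finset.abs_sum_le_sum_abs _ _).trans (Finset.sum_le_sum fun j _ => ?_)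
  rw [abs_mul]
  exact mul_le_mul_of_nonneg_left (hC j x) (abs_nonneg _)

/-- Two expressions of an `ℝ`-line bundle through pullbacks of `𝒪(1)` define the same height up
to a bounded function. -/
theorem exists_abs_sub_le_of_sum_eq [IsProper X.hom] {a b : ℕ} {N : Fin a → ℕ} {N' : Fin b → ℕ}
    (φ : ∀ l, X ⟶ projectiveSpace K (N l)) (ψ : ∀ l, X ⟶ projectiveSpace K (N' l))
    (r : Fin a → ℝ) (t : Fin b → ℝ)
    (h : ∑ l, r l ⊗ₜ[ℤ] Pic.pullback (φ l).left (twistingClass K (N l)) =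
      ∑ l, t l ⊗ₜ[ℤ] Pic.pullback (ψ l).left (twistingClass K (N' l))) :
    ∃ C : ℝ, ∀ x : GeomPoints X,
      |∑ l, r l * naiveHeight (x ≫ φ l) - ∑ l, t l * naiveHeight (x ≫ ψ l)| ≤ C := by
  let χ : ∀ l : Fin a ⊕ Fin b, X ⟶ projectiveSpace K (Sum.elim N N' l) :=
    fun l => Sum.rec (motive := fun l => X ⟶ projectiveSpace K (Sum.elim N N' l)) φ ψ l
  obtain ⟨C, hC⟩ := exists_abs_real_sum_mul_naiveHeight_le χ (Sum.elim r fun l => -t l) (by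
    rw [Fintype.sum_sum_type]
    simp only [Sum.elim_inl, Sum.elim_inr, TensorProduct.neg_tmul, Finset.sum_neg_distrib]
    exact add_neg_eq_zero.mpr h)
  refine ⟨C, fun x => ?_⟩
  have := hC x
  rw [Fintype.sum_sum_type] at this
  simpa only [Sum.elim_inl, Sum.elim_inr, neg_mul, Finset.sum_neg_distrib,
    ← sub_eq_add_neg] using this

end RealRelations

/-! ### Northcott's finiteness property. -/

section Northcott

variable {K : Type u} [Field K] {X : Over (Spec (.of K))}

theorem geomPoint_ext {x y : GeomPoints X} {U : X.left.Opens} (hU : IsAffineOpen U)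
    (hx : geomImage x ∈ U) (hy : geomImage y ∈ U)
    (h : ∀ a, value x U hx a = value y U hy a) : x = y := by
  have h1 : (geomHom x).appLE U ⊤ (top_le_preimage_geomHom x hx) =
      (geomHom y).appLE U ⊤ (top_le_preimage_geomHom y hy) := by
    rw [← cancel_mono (Scheme.ΓSpecIso (.of (AlgebraicClosure K))).hom]
    exact CommRingCat.hom_ext (RingHom.ext h)
  have hx' := hU.SpecMap_appLE_fromSpec (geomHom x) (isAffineOpen_top _)
    (top_le_preimage_geomHom x hx)
  have hy' := hU.SpecMap_appLE_fromSpec (geomHom y) (isAffineOpen_top _)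
    (top_le_preimage_geomHom y hy)
  rw [h1, hy', IsAffineOpen.fromSpec_top, cancel_epi] at hx'
  exact Over.OverMorphism.ext hx'.symm

/-- Equal coordinates put `q` into the chart chosen for `p`. Functions there are polynomials in
ratios of coordinates, so all their values agree. -/
theorem homogCoords_injective {n : ℕ} :
    Function.Injective (homogCoords (K := K) (n := n)) := fun p q h => by
  have hp := mem_stdOpen_chartIndex (geomImage p)
  have hq : geomImage q ∈ stdOpen (K := K) (chartIndex (geomImage p)) :=
    mem_stdOpen_of_homogCoords_ne_zero q _ (by
      rw [← h, homogCoords_chartIndex]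
      exact one_ne_zero)
  refine geomPoint_ext (isAffineOpen_stdOpen _) hp hq fun a => ?_
  obtain ⟨P, rfl⟩ := exists_eq_eval₂_coordRatio _ a
  rw [value_eval₂, value_eval₂]
  simp only [value_coordRatio, h]

theorem comp_injective_of_isClosedImmersion {Y : Over (Spec (.of K))} (ψ : X ⟶ Y)
    [IsClosedImmersion ψ.left] : Function.Injective fun x : GeomPoints X => x ≫ ψ := by
  have : Mono ψ := Over.mono_of_mono_left ψ
  exact fun x y h => (cancel_mono ψ).mp h

/-- The height of a number is that of the pair `(c j, 1)`, a subtuple of `c` because `c i = 1`. -/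
theorem logHeight₁_le_logHeight {F : Type*} [Field F] [NumberField F] {ι : Type*} [Finite ι]
    {c : ι → F} {i : ι} (hi : c i = 1) (j : ι) : Height.logHeight₁ (c j) ≤ Height.logHeight c := by
  rw [Height.logHeight₁_eq_logHeight]
  refine le_of_eq_of_le (congrArg Height.logHeight ?_) (Height.logHeight_comp_le ![j, i] c)
  funext l
  fin_cases l
  · rfl
  · exact hi.symm

/-- There are only finitely many points of bounded height on projective space with coordinates in
a fixed number field. -/
theorem finite_setOf_naiveHeight_le [NumberField K] (F : IntermediateField K (AlgebraicClosure K))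
    [NumberField F] (n : ℕ) (B : ℝ) :
    {p : GeomPoints (projectiveSpace K n) | (∀ j, homogCoords p j ∈ F) ∧
      naiveHeight p ≤ B}.Finite := by
  -- The factor `[F : ℚ]` turns the absolute height into the height relative to `F`.
  let T : Set F := {z | Height.logHeight₁ z ≤ Module.finrank ℚ F * B}
  have hT : T.Finite := NumberField.finite_setOfPred_logHeight₁_le F _
  have hS : {c : Fin (n + 1) → AlgebraicClosure K |
      ∀ j, c j ∈ (algebraMap F (AlgebraicClosure K)) '' T}.Finite :=
    Set.Finite.pi' fun _ => hT.image _
  refine (hS.preimage homogCoords_injective.injOn).subset ?_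
  rintro p ⟨hpF, hpB⟩ j
  let c : Fin (n + 1) → F := fun j => ⟨_, hpF j⟩
  refine ⟨c j, ?_, rfl⟩
  have hc : c (chartIndex (geomImage p)) = 1 := Subtype.ext (homogCoords_chartIndex p)
  refine (logHeight₁_le_logHeight hc j).trans ?_
  rw [naiveHeight_eq c fun _ => rfl] at hpB
  exact (inv_mul_le_iff₀ (Nat.cast_pos.mpr Module.finrank_pos)).mp hpB

end Northcott

/-! ### Heights along forward orbits. -/

section Dynamics

/-- If `μ` is the infimum of `h`, the functional equation gives `d * h y ≥ k * μ` for all `y`, hence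
`d * μ ≥ k * μ`, and `μ ≥ 0` because `d > k`. -/
theorem nonneg_of_sum_comp_eq {S : Type*} {k : ℕ} {g : Fin k → S → S} {d : ℝ} (hd : (k : ℝ) < d)
    {h : S → ℝ} (hh : ∀ x, ∑ i, h (g i x) = d * h x) {C : ℝ} (hC : ∀ x, C ≤ h x) (x : S) :
    0 ≤ h x := by
  have hbdd : BddBelow (Set.range h) := ⟨C, by rintro _ ⟨y, rfl⟩; exact hC y⟩
  have hm : ∀ y, ⨅ z, h z ≤ h y := fun y => ciInf_le hbdd y
  have hd0 : 0 < d := (Nat.cast_nonneg k).trans_lt hd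
  have : Nonempty S := ⟨x⟩
  have h1 : k * (⨅ z, h z) / d ≤ ⨅ z, h z := le_ciInf fun y => by
    rw [div_le_iff₀' hd0, ← hh y]
    calc k * (⨅ z, h z) = ∑ _i : Fin k, ⨅ z, h z := by simp
      _ ≤ _ := Finset.sum_le_sum fun i _ => hm (g i y)
  rw [div_le_iff₀' hd0] at h1
  exact le_trans (by nlinarith) (hm x)

variable {K : Type u} [Field K] {X : Over (Spec (.of K))} {k : ℕ}

theorem mem_forwardOrbit_self (f : Fin k → (X ⟶ X)) (x : GeomPoints X) : x ∈ forwardOrbit f x :=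
  ⟨[], rfl⟩

theorem comp_mem_forwardOrbit {f : Fin k → (X ⟶ X)} {x y : GeomPoints X}
    (hy : y ∈ forwardOrbit f x) (i : Fin k) : y ≫ f i ∈ forwardOrbit f x := by
  obtain ⟨w, rfl⟩ := hy
  exact ⟨i :: w, rfl⟩

theorem forwardOrbit_induction {f : Fin k → (X ⟶ X)} {x : GeomPoints X}
    {p : GeomPoints X → Prop} (h0 : p x) (h1 : ∀ y i, p y → p (y ≫ f i))
    {y : GeomPoints X} (hy : y ∈ forwardOrbit f x) : p y := by
  obtain ⟨w, rfl⟩ := hy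
  induction w with
  | nil => exact h0
  | cons i w ih => exact h1 _ i ih

/-- Since orbit points are images of `x` under morphisms over `K`, a field containing the values of
functions at `x` serves the whole orbit. -/
theorem exists_eq_comp_of_mem_forwardOrbit {f : Fin k → (X ⟶ X)} {x y : GeomPoints X}
    (hy : y ∈ forwardOrbit f x) : ∃ g : X ⟶ X, y = x ≫ g :=
  forwardOrbit_induction (p := fun y => ∃ g : X ⟶ X, y = x ≫ g) ⟨𝟙 X, (Category.comp_id x).symm⟩
    (by rintro _ i ⟨g, rfl⟩; exact ⟨g ≫ f i, Category.assoc _ _ _⟩) hy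

/-- An ample `ℝ`-line bundle is a positive combination of pullbacks of `𝒪(1)` under closed
immersions. -/
theorem IsAmpleReal.exists_eq_sum {L : RealPic X.left} (hL : IsAmpleReal X L) :
    ∃ (m : ℕ) (t : Fin (m + 1) → ℝ) (N : Fin (m + 1) → ℕ)
      (ψ : ∀ i, X ⟶ projectiveSpace K (N i)),
      (∀ i, 0 < t i ∧ IsClosedImmersion (ψ i).left) ∧
      L = ∑ i, t i ⊗ₜ[ℤ] Pic.pullback (ψ i).left (twistingClass K (N i)) := by
  obtain ⟨m, r, A, hA, rfl⟩ := hL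
  choose e he N ψ hψ h using fun i => (hA i).2
  -- Only the multiple `e i • A i` is very ample, so its coefficient is divided by `e i`.
  refine ⟨m, fun i => r i / e i, N, ψ,
    fun i => ⟨div_pos (hA i).1 (Nat.cast_pos.mpr (he i)), hψ i⟩, Finset.sum_congr rfl fun i _ => ?_⟩
  rw [← h i, ← natCast_zsmul, ← TensorProduct.smul_tmul, natCast_zsmul, nsmul_eq_mul,
    mul_div_cancel₀ _ (Nat.cast_ne_zero.mpr (he i).ne')]

variable [NumberField K]

/-- A Weil height of an ample `ℝ`-line bundle is, up to a bounded function, a positive combination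
of pullbacks of naive heights under closed immersions. -/
theorem IsWeilHeight.exists_abs_sub_le_of_isAmpleReal [IsProper X.hom] {L : RealPic X.left}
    {h : GeomPoints X → ℝ} (hh : IsWeilHeight L h) (hL : IsAmpleReal X L) :
    ∃ (m : ℕ) (t : Fin (m + 1) → ℝ) (N : Fin (m + 1) → ℕ)
      (ψ : ∀ i, X ⟶ projectiveSpace K (N i)) (C : ℝ),
      (∀ i, 0 < t i ∧ IsClosedImmersion (ψ i).left) ∧
      ∀ x, |h x - ∑ i, t i * naiveHeight (x ≫ ψ i)| ≤ C := by
  obtain ⟨a, r, M, φ, C₁, hL₁, h₁⟩ := hh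
  obtain ⟨m, t, N, ψ, hψ, hL₂⟩ := hL.exists_eq_sum
  obtain ⟨C₂, h₂⟩ := exists_abs_sub_le_of_sum_eq φ ψ r t (hL₁.symm.trans hL₂)
  exact ⟨m, t, N, ψ, C₁ + C₂, hψ, fun x =>
    (abs_sub_le _ _ _).trans (add_le_add (h₁ x) (h₂ x))⟩

theorem naiveHeight_nonneg {n : ℕ} (p : GeomPoints (projectiveSpace K n)) : 0 ≤ naiveHeight p :=
  absLogHeight_nonneg (homogCoords p)

end Dynamics

end CanonicalHeight

end

/-! ### The main theorem. -/

open CanonicalHeight in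
theorem proposition1p3p1 {K : Type u} [Field K] [NumberField K]
    (X : Over (Spec (.of K))) [IsIntegral X.left] (hX : IsProjective X)
    {k : ℕ} (f : Fin k → (X ⟶ X)) (L : RealPic X.left) (d : ℝ)
    (hf : IsDynamicalSystem f L d) (hL : IsAmpleReal X L)
    (h : GeomPoints X → ℝ) (hh : IsCanonicalHeight f L d h) :
    (∀ x : GeomPoints X, 0 ≤ h x) ∧
      ∀ x : GeomPoints X, h x = 0 ↔ (forwardOrbit f x).Finite := by
  have := hX.isProper
  have hd := hf.1
  obtain ⟨hW, hfun⟩ := hh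
  obtain ⟨m, t, N, ψ, C, hψ, hC⟩ := hW.exists_abs_sub_le_of_isAmpleReal hL
  have hterm : ∀ (x : GeomPoints X) (i : Fin (m + 1)), 0 ≤ t i * naiveHeight (x ≫ ψ i) :=
    fun x i => mul_nonneg (hψ i).1.le (naiveHeight_nonneg _)
  have hnonneg : ∀ x, 0 ≤ h x := nonneg_of_sum_comp_eq (g := fun i x => x ≫ f i) hd hfun
    (C := -C) fun x => by
      have h1 := (abs_le.mp (hC x)).1
      have h2 := Finset.sum_nonneg fun i (_ : i ∈ Finset.univ) => hterm x i
      linarith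
  refine ⟨hnonneg, fun x => ⟨fun hx => ?_, fun hfin => ?_⟩⟩
  · have hzero : ∀ y ∈ forwardOrbit f x, h y = 0 := fun y hy =>
      forwardOrbit_induction (p := fun y => h y = 0) hx (fun y i hy => by
        -- A sum of nonnegative terms equal to 0 has all its terms 0.
        have hsum := hfun y
        rw [hy, mul_zero, Finset.sum_eq_zero_iff_of_nonneg fun i _ => hnonneg _] at hsum
        exact hsum i (Finset.mem_univ i)) hy
    obtain ⟨F, hFin, hF⟩ := exists_finiteDimensional_value_mem x
    have : NumberField F := NumberField.of_module_finite K F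
    have := (hψ 0).2
    -- A single embedding `ψ 0` suffices: on the orbit `t 0 * naiveHeight` is at most the full sum,
    -- which is at most `C` where `h` vanishes.
    refine ((finite_setOf_naiveHeight_le F (N 0) ((t 0)⁻¹ * C)).preimage
      (comp_injective_of_isClosedImmersion (ψ 0)).injOn).subset fun y hy => ⟨fun j => ?_, ?_⟩
    · obtain ⟨g, rfl⟩ := exists_eq_comp_of_mem_forwardOrbit hy
      have := homogCoords_comp_mem hF (g ≫ ψ 0) j
      rwa [← Category.assoc] at this
    · rw [← div_eq_inv_mul, le_div_iff₀' (hψ 0).1]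
      have h1 := (abs_le.mp (hC y)).1
      have h2 := Finset.single_le_sum (fun i _ => hterm y i) (Finset.mem_univ 0)
      rw [hzero y hy] at h1
      linarith
  · obtain ⟨y, hy, hmax⟩ := hfin.exists_maximalFor h _ ⟨x, mem_forwardOrbit_self f x⟩
    have hle : ∀ z ∈ forwardOrbit f x, h z ≤ h y := fun z hz =>
      (le_total (h z) (h y)).elim id (hmax hz)
    have hsum : d * h y ≤ k * h y := by
      rw [← hfun y]
      calc ∑ i, h (y ≫ f i) ≤ ∑ _i : Fin k, h y :=
            Finset.sum_le_sum fun i _ => hle _ (comp_mem_forwardOrbit hy i)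
        _ = k * h y := by simp
    -- `h y > 0` would contradict `d * h y ≤ k * h y`, as `k < d`.
    have hy0 : h y ≤ 0 := by nlinarith [hnonneg y]
    exact le_antisymm ((hle x (mem_forwardOrbit_self f x)).trans hy0) (hnonneg x)
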